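/- Let $\Sigma$ be a finite alphabet with at least two symbols. There is an infinite sequence $S\in\Sigma^\infty$ with $$R_{\mathrm{plogon}}(S)=0\quad\text{and}\quad \rho_{\mathrm{PD}}(S)=1,$$ where the two ratios are defined as follows. For $T:\Sigma^*\to\Sigma^*$ put $\rho_T(S)=\liminf_{n\to\infty}|T(S[1..n])|/n$ and $R_T(S)=\limsup_{n\to\infty}|T(S[1..n])|/n$. *Plogon.* A plogon transducer is a deterministic Turing machine that halts on every input $w\in\Sigma^*$, reads $w$ once from left to right, is given $|w|$ in binary on a special read-only tape, writes its output in $\Sigma^*$ from left to right on a write-only tape, and uses work space polynomial in $\log|w|$ (formally, at most $(\lfloor\log_2|w|\rfloor+2)^c$ cells on each of its finitely many work tapes, for a constant $c$, where $\lfloor\log_2 0\rfloor$ is read as $0$). $R_{\mathrm{plogon}}(S)$ is the infimum of $R_T(S)$ over all one-to-one functions $T:\Sigma^*\to\Sigma^*$ computed by plogon transducers. *Pushdown.* A bounded pushdown compressor with endmarker is a deterministic pushdown transducer with finite state set $Q$, finite stack alphabet $\Gamma$, input alphabet $\Sigma\cup\{\$\}$ where $\$\notin\Sigma$, a partial transition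 function $\delta:Q\times(\Sigma\cup\{\$,\lambda\})\times\Gamma\to Q\times\Gamma^*$, a total output function $\nu:Q\times(\Sigma\cup\{\$\})\times\Gamma\to\Sigma^*$, an initial state $q_0$, and a start stack symbol $z_0$ that is never removed from the bottom of the stack. A transition depends on the state and the top stack symbol and replaces that symbol by a word. A $\lambda$-rule reads no input and pops the top stack symbol; it is never defined for a state and top symbol for which a transition reading an input symbol is defined. $\lambda$-rules are applied as long as possible after each input symbol, and a constant bounds how many are applied after each input symbol. Reading $b$ in state $q$ with top stack symbol $a$ outputs $\nu(q,b,a)$; $C(w\$)$ is the concatenated output on $w\$$, and $\delta_Q(w)$ is the state reached on $w$. $C$ is information-lossless if $w\mapsto(C(w\$),\delta_Q(w))$ is defined on all of $\Sigma^*$ and one-to-one. $\rho_{\mathrm{PD}}(S)$ is the infimum, over all such information-lossless $C$, of $\liminf_{n\to\infty}|C(S[1..n]\$)|/n$. -/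

import Mathlib

open Filter
open scoped ENNReal

universe u v

/-! ### Sequences, prefixes and compression ratios -/

/-- The prefix `S[1..n]` of an infinite sequence (positions are counted from `0` here). -/
def seqPrefix {A : Type u} (S : ℕ → A) (n : ℕ) : List A :=
  (List.range n).map S

/-- `ρ_T(S) = liminf |T(S[1..n])| / n`. -/
noncomputable def lowerRatio {A : Type u} (T : List A → List A) (S : ℕ → A) : ℝ≥0∞ :=
  liminf (fun n : ℕ => ((T (seqPrefix S n)).length : ℝ≥0∞) / (n : ℝ≥0∞)) atTop

/-- `R_T(S) = limsup |T(S[1..n])| / n`. -/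
noncomputable def upperRatio {A : Type u} (T : List A → List A) (S : ℕ → A) : ℝ≥0∞ :=
  limsup (fun n : ℕ => ((T (seqPrefix S n)).length : ℝ≥0∞) / (n : ℝ≥0∞)) atTop

/-! ### Pushdown compressors -/

/-- The data `(Q, A, Γ, δ, ν, q₀, z₀, c)` of a pushdown compressor with input alphabet `A` and
output alphabet `B`. In `δ q b a`, the value `b = none` stands for the empty word (a `λ`-rule),
`a` is the top stack symbol, and the result `none` means "undefined". Stacks are lists whose
head is the top symbol. -/
structure PushdownCompressor (A : Type u) (B : Type v) where
  /-- states -/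
  Q : Type
  /-- stack alphabet -/
  Γ : Type
  finite_Q : Finite Q
  finite_Γ : Finite Γ
  /-- transition function; the word that replaces the top symbol is returned -/
  δ : Q → Option A → Γ → Option (Q × List Γ)
  /-- output function -/
  ν : Q → A → Γ → List B
  /-- initial state -/
  q₀ : Q
  /-- start stack symbol -/
  z₀ : Γ
  /-- bound on the number of `λ`-rules per input symbol -/
  c : ℕ
  /-- the start symbol cannot be removed from the bottom of the stack -/
  bottom : ∀ q b p, δ q b z₀ = some p → ∃ v, p.2 = v ++ [z₀]
  /-- a `λ`-rule pops the top symbol -/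
  lambda_pops : ∀ q a p, δ q none a = some p → p.2 = []
  /-- determinism -/
  deterministic : ∀ q a, δ q none a = none ∨ ∀ b, δ q (some b) a = none

namespace PushdownCompressor

/-- Apply `λ`-rules as long as possible. Each of them pops the top symbol. -/
def lambdaClosure {A : Type u} {B : Type v} (C : PushdownCompressor A B) :
    C.Q → List C.Γ → C.Q × List C.Γ
  | q, [] => (q, [])
  | q, a :: y =>
    match C.δ q none a with
    | none => (q, a :: y)
    | some p => lambdaClosure C p.1 y

/-- The number of `λ`-rules applied by `lambdaClosure`. -/
def lambdaCount {A : Type u} {B : Type v} (C : PushdownCompressor A B) :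
    C.Q → List C.Γ → ℕ
  | _, [] => 0
  | q, a :: y =>
    match C.δ q none a with
    | none => 0
    | some p => lambdaCount C p.1 y + 1

/-- One transition that consumes the input symbol `b`; only the top of the stack matters. -/
def readSymbol {A : Type u} {B : Type v} (C : PushdownCompressor A B)
    (b : A) : C.Q × List C.Γ → Option (C.Q × List C.Γ)
  | (_, []) => none
  | (q, a :: y) => (C.δ q (some b) a).map fun p => (p.1, p.2 ++ y)

/-- Consume `b`, then apply `λ`-rules. -/
def next {A : Type u} {B : Type v} (C : PushdownCompressor A B)
    (s : Option (C.Q × List C.Γ)) (b : A) : Option (C.Q × List C.Γ) :=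
  (s.bind (C.readSymbol b)).map fun t => C.lambdaClosure t.1 t.2

/-- The extended transition function `δ(w)`, from the initial state and the stack `z₀`. -/
def run {A : Type u} {B : Type v} (C : PushdownCompressor A B) (w : List A) :
    Option (C.Q × List C.Γ) :=
  w.foldl C.next (some (C.lambdaClosure C.q₀ [C.z₀]))

/-- The state `δ_Q(w)` reached on `w`. -/
def finalState {A : Type u} {B : Type v} (C : PushdownCompressor A B) (w : List A) :
    Option C.Q :=
  (C.run w).map Prod.fst

/-- The output produced while reading a word from a given configuration. Every symbol `b` adds
`ν q b a`, where `q` is the state and `a` the top of the stack just before `b` is read. -/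
def outputFrom {A : Type u} {B : Type v} (C : PushdownCompressor A B) :
    Option (C.Q × List C.Γ) → List A → Option (List B)
  | _, [] => some []
  | s, b :: w =>
    s.bind fun t =>
      t.2.head?.bind fun a =>
        (outputFrom C (C.next s b) w).map fun o => C.ν t.1 b a ++ o

/-- The output `C(w)`. -/
def output {A : Type u} {B : Type v} (C : PushdownCompressor A B) (w : List A) :
    Option (List B) :=
  C.outputFrom (some (C.lambdaClosure C.q₀ [C.z₀])) w

/-- At most `c` `λ`-rules are applied after each input symbol. (None can be applied before the
first one, because the stack is then `z₀`.) -/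
def IsBounded {A : Type u} {B : Type v} (C : PushdownCompressor A B) : Prop :=
  ∀ (w : List A) (b : A) (s t : C.Q × List C.Γ),
    C.run w = some s → C.readSymbol b s = some t → C.lambdaCount t.1 t.2 ≤ C.c

/-- The word `w$`; the endmarker `$` is `none : Option A`. -/
def withEnd {A : Type u} (w : List A) : List (Option A) :=
  w.map some ++ [none]

/-- The function `w ↦ C(w$)`. -/
def endOutput {A : Type u} (C : PushdownCompressor (Option A) A) (w : List A) : List A :=
  (C.output (withEnd w)).getD []

/-- Information-lossless pushdown compressor with endmarkers: the number of `λ`-rules is bounded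
and `w ↦ (C(w$), δ_Q(w))` is defined on all words over `A` and one-to-one. -/
def IsILPDCwE {A : Type u} (C : PushdownCompressor (Option A) A) : Prop :=
  C.IsBounded ∧
  (∀ w : List A, (C.output (withEnd w)).isSome ∧ (C.finalState (w.map some)).isSome) ∧
  Function.Injective fun w : List A => (C.output (withEnd w), C.finalState (w.map some))

end PushdownCompressor

/-- The best-case pushdown compression ratio `ρ_PD(S)`. -/
noncomputable def rhoPD {A : Type u} (S : ℕ → A) : ℝ≥0∞ :=
  ⨅ (C : PushdownCompressor (Option A) A) (_ : C.IsILPDCwE), lowerRatio C.endOutput S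

/-! ### Online polylogarithmic-space transducers -/

/-- Head movements. -/
inductive HeadMove : Type
  | left
  | stay
  | right

/-- The new position of a head on a tape whose cells are numbered `0, 1, 2, …`. -/
def HeadMove.apply : HeadMove → ℕ → ℕ
  | left, i => i - 1
  | stay, i => i
  | right, i => i + 1

/-- What a machine does in one step. -/
structure OnlineAction (A : Type u) (Q Γ K : Type) where
  /-- new state -/
  state : Q
  /-- whether the input head moves on to the next symbol -/
  advance : Bool
  /-- movement on the tape that holds the length of the input -/
  lenMove : HeadMove
  /-- symbols written on the work tapes -/
  write : K → Γ
  /-- movements on the work tapes, after writing -/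
  move : K → HeadMove
  /-- the symbol appended to the output, if any -/
  emit : Option A

/-- A deterministic Turing machine with a one-way read-only input tape, a two-way read-only tape
that holds the length of the input in binary, finitely many work tapes (indexed by `K`), and a
one-way write-only output tape. The transition function sees the state, the input symbol
(`none` at the end of the input), the symbol of the length tape (`none` to the right of the
last digit) and the scanned work symbols; its value `none` means that the machine halts. -/
structure OnlineTM (A : Type u) where
  /-- states -/
  Q : Type
  /-- work alphabet -/
  Γ : Type
  /-- names of the work tapes -/
  K : Type
  finite_Q : Finite Q
  finite_Γ : Finite Γ
  finite_K : Finite K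
  /-- initial state -/
  q₀ : Q
  /-- blank symbol -/
  blank : Γ
  /-- transition function -/
  δ : Q → Option A → Option Bool → (K → Γ) → Option (OnlineAction A Q Γ K)

namespace OnlineTM

/-- Configurations. -/
structure Config {A : Type u} (M : OnlineTM A) where
  state : M.Q
  /-- the part of the input that has not been passed yet -/
  unread : List A
  lenHead : ℕ
  head : M.K → ℕ
  tape : M.K → ℕ → M.Γ
  /-- the output written so far -/
  output : List A

/-- The content of the length tape: the binary digits, most significant digit first. -/
def lengthTape (n : ℕ) : List Bool :=
  (Nat.bits n).reverse

/-- The start configuration on input `w`. -/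
def init {A : Type u} (M : OnlineTM A) (w : List A) : M.Config where
  state := M.q₀
  unread := w
  lenHead := 0
  head := fun _ => 0
  tape := fun _ _ => M.blank
  output := []

/-- One step, where `d` is the content of the length tape. The head of the length tape cannot go
beyond the first blank to the right of the digits. -/
def step {A : Type u} (M : OnlineTM A) (d : List Bool) (s : M.Config) : Option M.Config :=
  (M.δ s.state s.unread.head? d[s.lenHead]? (fun k => s.tape k (s.head k))).map fun a =>
    { state := a.state
      unread := if a.advance then s.unread.tail else s.unread
      lenHead := min (a.lenMove.apply s.lenHead) d.length
      head := fun k => (a.move k).apply (s.head k)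
      tape := fun k => Function.update (s.tape k) (s.head k) (a.write k)
      output := s.output ++ a.emit.toList }

/-- `M` reaches the configuration `s` in its computation on input `w`. -/
def Reaches {A : Type u} (M : OnlineTM A) (w : List A) (s : M.Config) : Prop :=
  StateTransition.Reaches (M.step (lengthTape w.length)) (M.init w) s

/-- On input `w`, `M` halts with output `o`. -/
def Outputs {A : Type u} (M : OnlineTM A) (w o : List A) : Prop :=
  ∃ s : M.Config, M.Reaches w s ∧ M.step (lengthTape w.length) s = none ∧ s.output = o

/-- On input `w`, every work head stays within the first `b` cells of its tape. -/
def SpaceWithin {A : Type u} (M : OnlineTM A) (w : List A) (b : ℕ) : Prop :=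
  ∀ s : M.Config, M.Reaches w s → ∀ k, s.head k < b

end OnlineTM

/-- `T` is computed by a plogon transducer: an online Turing machine that uses space polynomial
in the logarithm of the length of the input. -/
def IsPlogon {A : Type u} (T : List A → List A) : Prop :=
  ∃ M : OnlineTM A, (∀ w, M.Outputs w (T w)) ∧
    ∃ c : ℕ, ∀ w : List A, M.SpaceWithin w ((Nat.log 2 w.length + 2) ^ c)

/-- Information-lossless plogon compressors. -/
def IsILplog {A : Type u} (T : List A → List A) : Prop :=
  IsPlogon T ∧ Function.Injective T

/-- The worst-case plogon compression ratio `R_plogon(S)`. -/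
noncomputable def RPlogon {A : Type u} (S : ℕ → A) : ℝ≥0∞ :=
  ⨅ (T : List A → List A) (_ : IsILplog T), upperRatio T S

/-! ### A dictionary compressor -/

namespace DictCompressor

/-! A dictionary of bounded size fits into logarithmic work space once the input is long enough, and
a plogon machine can compare the input with any entry. A pushdown compressor is weaker: while it
reads `t` symbols, its output depends only on its state and on `O(t)` symbols at the top of its
stack. So its contexts fall into at most `K ^ t` types.

Fix finitely many compressors and `q`, and consider lists of `N` words of length `(q + 1) * ℓ`. For
one type of context, losslessness lets only about a fraction `σ ^ (-ℓ * N)` of the lists have every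
word compressed below `q * ℓ` by some compressor. There are only exponentially many types in `ℓ`, so
a number `N` independent of `ℓ` beats them. One list therefore contains, for every context, a word
that all the given compressors fail to compress (`exists_incompressible_words`). Since `N` stays
fixed while `ℓ` grows, the index of a word is short compared with the word.

The sequence is built in stages. A header inserts such a list, aimed at the first `q + 1`
compressors, into the dictionary. Then the stage `q` appends lookups `b^i a d a` of a word `d` of
that list, where `i` is chosen anew for the context reached. The dictionary compressor replaces a
lookup by `b^i a a a` (`enc_lookup`), while the pushdown compressors lose at most a fraction `2 / (q
+ 1)` (`exists_lookup`). Stages last so long that headers and single lookups are negligible, and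
that the logarithm of the length exceeds the size of the next dictionary (`StagedGrowth`). All
pushdown compressors are treated at once because they have only countably many output-length
functions. -/

@[simp]
theorem apply_left (h : ℕ) : HeadMove.left.apply h = h - 1 := rfl

@[simp]
theorem apply_stay (h : ℕ) : HeadMove.stay.apply h = h := rfl

@[simp]
theorem apply_right (h : ℕ) : HeadMove.right.apply h = h + 1 := rfl

/-- The first position at or to the right of `h` whose cell holds no symbol, searched for in
`fuel` steps. A cell is `none` (the left end mark), `some none` (a blank), or holds a symbol. -/
def skipFrom {B : Type} (t : ℕ → Option (Option B)) : ℕ → ℕ → ℕ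
  | 0, h => h
  | fuel + 1, h => if (t h).join.isSome then skipFrom t fuel (h + 1) else h

theorem skipFrom_le {B : Type} (t : ℕ → Option (Option B)) (fuel h : ℕ) :
    skipFrom t fuel h ≤ h + fuel := by
  induction fuel generalizing h with
  | zero => simp [skipFrom]
  | succ n ih =>
    rw [skipFrom]
    split_ifs
    · have := ih (h + 1); omega
    · omega

/-- The states of the compressor. -/
inductive Mode : Type
  | init | scan | home | cmd | skip | read | flag | write | esc | copy

instance : Finite Mode :=
  Finite.of_surjective (fun i : Fin 10 => (![.init, .scan, .home, .cmd, .skip, .read, .flag, .write,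
    .esc, .copy] : Fin 10 → Mode) i) fun m => by
      cases m
      exacts [⟨0, rfl⟩, ⟨1, rfl⟩, ⟨2, rfl⟩, ⟨3, rfl⟩, ⟨4, rfl⟩, ⟨5, rfl⟩, ⟨6, rfl⟩, ⟨7, rfl⟩,
        ⟨8, rfl⟩, ⟨9, rfl⟩]

/-- The start content of the work tape. -/
def startTape (B : Type) : ℕ → Option (Option B) :=
  Function.update (fun _ => some none) 0 none

theorem startTape_eq_none_iff {B : Type} (i : ℕ) : startTape B i = none ↔ i = 0 := by
  by_cases hi : i = 0 <;> simp [startTape, hi]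

/-- The code of an unfinished word that was matched up to the cell `h`, followed by the rest `w` of
the input. -/
def escape {A : Type u} (a b : A) (h : ℕ) (w : List A) : List A :=
  b :: (List.replicate h a ++ b :: w)

theorem length_escape {A : Type u} (a b : A) (h : ℕ) (w : List A) :
    (escape a b h w).length = h + w.length + 2 := by
  simp [escape]
  omega

/-- The unary code `a^m b` is self-delimiting. It transmits the number of cells and the position of
an escape, and it serves as padding in a counting argument. -/
theorem replicate_append_cons_inj {A : Type u} {a b : A} (hab : a ≠ b) {m n : ℕ} {v w : List A}
    (h : List.replicate m a ++ b :: v = List.replicate n a ++ b :: w) : m = n ∧ v = w := by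
  induction m generalizing n with
  | zero =>
    cases n with
    | zero => simpa using h
    | succ n => simp [List.replicate_succ, hab.symm] at h
  | succ m ih =>
    cases n with
    | zero => simp [List.replicate_succ, hab] at h
    | succ n => simpa using ih (by simpa [List.replicate_succ] using h)

theorem escape_inj {A : Type u} {a b : A} (hab : a ≠ b) {h : ℕ} {v w : List A}
    (H : escape a b h v = escape a b h w) : v = w := by
  rw [escape, escape, List.cons.injEq] at H
  exact (replicate_append_cons_inj hab H.2).2

/-! ### The encoder and the Turing machine that computes it -/

section

variable {A : Type u} {B : Type} [DecidableEq A] [DecidableEq B] (a b : A) (e : A → B)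

/-- The output of the compressor on the rest of the input, started in the mode `cmd`, `read` or
`write` with tape content `t` and head position `h`, where `D` is the number of available cells. -/
def enc (D : ℕ) : Mode → (ℕ → Option (Option B)) → ℕ → List A → List A
  | .cmd, _, _, [] => []
  | .cmd, t, h, s :: w =>
    if h < D then
      s :: (if s = a then enc D .read t (h + 1) w
        else enc D .cmd t (skipFrom t (D - (h + 1)) (h + 1)) w)
    else s :: w
  | .read, t, h, [] =>
    if h < D ∧ (t h).join = none then [a] else escape a b h []
  | .read, t, h, s :: w =>
    if h < D then
      match (t h).join with
      | some x => if e s = x then enc D .read t (h + 1) w else escape a b h (s :: w)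
      -- The flag `a` reports that the match ran up to a blank; the next symbol then chooses between
      -- returning to the start and writing.
      | none => a :: s :: (if s = a then enc D .cmd t 0 w else enc D .write t h w)
    else escape a b h (s :: w)
  | .write, _, _, [] => []
  | .write, t, h, s :: w =>
    if h < D then s :: enc D .read (Function.update t h (some (some (e s)))) (h + 1) w
    else s :: w
  | _, _, _, _ => []

/-- The function computed by the compressor. -/
def compress (w : List A) : List A :=
  List.replicate w.length.size a ++ b :: enc a b e w.length.size .cmd (startTape B) 0 w

/-- An action that moves the head of the work tape together with that of the length tape. -/
def act (q : Mode) (adv : Bool) (m : HeadMove) (c : Option (Option B)) (o : Option A) :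
    Option (OnlineAction A Mode (Option (Option B)) Unit) :=
  some ⟨q, adv, m, fun _ => c, fun _ => m, o⟩

/-- The transition table inside the available cells. -/
def innerTable (c : Option (Option B)) :
    Mode → Option A → Option (OnlineAction A Mode (Option (Option B)) Unit)
  | .init, _ => act .scan false .stay none none
  | .scan, _ => act .scan false .right c (some a)
  | .home, _ => if c = none then act .cmd false .stay c none else act .home false .left c none
  | .cmd, none => none
  | .cmd, some s => act (if s = a then .read else .skip) true .right c (some s)
  | .skip, _ => if c.join.isSome then act .skip false .right c none else act .cmd false .stay c none
  | .read, x =>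
    match c.join with
    | none => act .flag false .stay c (some a)
    | some y => if x.map e = some y then act .read true .right c none
        else act .esc false .stay c (some b)
  | .flag, none => none
  | .flag, some s => act (if s = a then .home else .write) true .stay c (some s)
  | .write, none => none
  | .write, some s => act .read true .right (some (some (e s))) (some s)
  | .esc, _ => if c = none then act .copy false .stay c (some b) else act .esc false .left c (some a)
  | .copy, none => none
  | .copy, some s => act .copy true .stay c (some s)

/-- The transition table to the right of the available cells. -/
def wallTable (c : Option (Option B)) :
    Mode → Option A → Option (OnlineAction A Mode (Option (Option B)) Unit)
  | .init, _ => act .scan false .stay none none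
  | .scan, _ => act .home false .stay c (some b)
  | .home, _ => if c = none then act .cmd false .stay c none else act .home false .left c none
  | .cmd, _ => act .copy false .stay c none
  | .skip, _ => act .cmd false .stay c none
  | .read, _ => act .esc false .stay c (some b)
  | .flag, _ => none
  | .write, _ => act .copy false .stay c none
  | .esc, _ => if c = none then act .copy false .stay c (some b) else act .esc false .left c (some a)
  | .copy, none => none
  | .copy, some s => act .copy true .stay c (some s)

/-- The action taken in the mode `q` with the head in position `h`. -/
def table (n h : ℕ) (c : Option (Option B)) (q : Mode) (x : Option A) :
    Option (OnlineAction A Mode (Option (Option B)) Unit) :=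
  if h < n then innerTable a b e c q x else wallTable a b c q x

/-- The two heads move together, so the length tape serves as a ruler for the work tape: beyond its
last digit no rule moves right. -/
theorem table_moves {a b : A} {e : A → B} {n h : ℕ} {c : Option (Option B)} {q : Mode} {x : Option A}
    {r : OnlineAction A Mode (Option (Option B)) Unit} (hr : table a b e n h c q x = some r) :
    (∀ k, r.move k = r.lenMove) ∧ (r.lenMove = .right → h < n) := by
  by_cases hn : h < n
  · refine ⟨?_, fun _ => hn⟩
    rw [table, if_pos hn] at hr
    cases q <;> cases x <;> simp only [innerTable, act] at hr <;>
      (try split at hr) <;> (try split at hr) <;> simp_all <;> subst hr <;> simp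
  · rw [table, if_neg hn] at hr
    cases q <;> cases x <;> simp only [wallTable, act] at hr <;>
      (try split at hr) <;> simp_all <;> subst hr <;> simp

/-- The online Turing machine that computes `compress`. -/
def machine [Finite B] : OnlineTM A where
  Q := Mode
  Γ := Option (Option B)
  K := Unit
  finite_Q := inferInstance
  finite_Γ := inferInstance
  finite_K := inferInstance
  q₀ := .init
  blank := some none
  δ q x l c := if l = none then wallTable a b (c ()) q x else innerTable a b e (c ()) q x

variable [Finite B]

/-- The configuration of the machine with both heads in position `h`. -/
def conf (q : Mode) (w : List A) (h : ℕ) (t : ℕ → Option (Option B)) (o : List A) :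
    (machine a b e).Config :=
  ⟨q, w, h, fun _ => h, fun _ => t, o⟩

/-- From the configuration `c` the machine halts with output `o`. -/
def HaltsWith (d : List Bool) (c : (machine a b e).Config) (o : List A) : Prop :=
  ∃ s, StateTransition.Reaches ((machine a b e).step d) c s ∧
    (machine a b e).step d s = none ∧ s.output = o

variable {a b e} {d : List Bool}

/-- Runs are verified backwards: each lemma on a mode prepends steps to a run already known to halt.
-/
theorem HaltsWith.of_step {c c' : (machine a b e).Config} {o : List A}
    (h : HaltsWith a b e d c' o) (hc : (machine a b e).step d c = some c') :
    HaltsWith a b e d c o := by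
  obtain ⟨s, hs, h⟩ := h
  exact ⟨s, Relation.ReflTransGen.head hc hs, h⟩

theorem HaltsWith.of_none {c : (machine a b e).Config}
    (hc : (machine a b e).step d c = none) : HaltsWith a b e d c c.output :=
  ⟨c, Relation.ReflTransGen.refl, hc, rfl⟩

theorem step_conf (q : Mode) (w : List A) (h : ℕ) (t : ℕ → Option (Option B)) (o : List A) :
    (machine a b e).step d (conf a b e q w h t o) =
      (table a b e d.length h (t h) q w.head?).map fun r =>
          { state := r.state
            unread := if r.advance then w.tail else w
            lenHead := min (r.lenMove.apply h) d.length
            head := fun k => (r.move k).apply h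
            tape := fun k => Function.update t h (r.write k)
            output := o ++ r.emit.toList } := by
  by_cases hd : h < d.length <;> simp [OnlineTM.step, conf, machine, hd, table]

theorem HaltsWith.of_act {q q' : Mode} {adv : Bool} {w : List A} {h : ℕ}
    {t : ℕ → Option (Option B)} {o : List A} {m : HeadMove} {c : Option (Option B)} {x : Option A}
    {r : List A}
    (ht : table a b e d.length h (t h) q w.head? = act q' adv m c x)
    (hm : m.apply h ≤ d.length)
    (H : HaltsWith a b e d (conf a b e q' (if adv then w.tail else w) (m.apply h)
      (Function.update t h c) (o ++ x.toList)) r) :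
    HaltsWith a b e d (conf a b e q w h t o) r := by
  refine H.of_step ?_
  rw [step_conf, ht]
  simp only [act, conf, Option.map_some, min_eq_left hm]
  rfl

theorem HaltsWith.of_table_none {q : Mode} {w : List A} {h : ℕ}
    {t : ℕ → Option (Option B)} {o : List A}
    (ht : table a b e d.length h (t h) q w.head? = none) :
    HaltsWith a b e d (conf a b e q w h t o) o := by
  refine HaltsWith.of_none ?_
  rw [step_conf, ht]
  rfl

theorem haltsWith_copy (w : List A) {h : ℕ} (hd : h ≤ d.length) (t : ℕ → Option (Option B))
    (o : List A) : HaltsWith a b e d (conf a b e .copy w h t o) (o ++ w) := by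
  induction w generalizing o with
  | nil =>
    rw [List.append_nil]
    exact .of_table_none (by simp [table, innerTable, wallTable])
  | cons s w ih =>
    refine .of_act (q' := .copy) (adv := true) (m := .stay) (c := t h) (x := some s)
      (by simp [table, innerTable, wallTable]) hd ?_
    simpa using ih (o ++ [s])

theorem haltsWith_home {w : List A} {h : ℕ} (hd : h ≤ d.length) {t : ℕ → Option (Option B)}
    (ht : ∀ i, t i = none ↔ i = 0) {o r : List A}
    (H : HaltsWith a b e d (conf a b e .cmd w 0 t o) r) :
    HaltsWith a b e d (conf a b e .home w h t o) r := by
  induction h with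
  | zero =>
    refine .of_act (q' := .cmd) (adv := false) (m := .stay) (c := t 0) (x := none)
      (by simp [table, innerTable, wallTable, (ht 0).2 rfl]) hd ?_
    simpa using H
  | succ h ih =>
    have h0 : t (h + 1) ≠ none := by simp [ht]
    refine .of_act (q' := .home) (adv := false) (m := .left) (c := t (h + 1)) (x := none)
      (by simp [table, innerTable, wallTable, h0]) (by simp only [apply_left]; omega) ?_
    simpa using ih (by omega)

theorem haltsWith_esc (w : List A) {h : ℕ} (hd : h ≤ d.length) {t : ℕ → Option (Option B)}
    (ht : ∀ i, t i = none ↔ i = 0) (o : List A) :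
    HaltsWith a b e d (conf a b e .esc w h t o) (o ++ (List.replicate h a ++ b :: w)) := by
  induction h generalizing o with
  | zero =>
    refine .of_act (q' := .copy) (adv := false) (m := .stay) (c := t 0) (x := some b)
      (by simp [table, innerTable, wallTable, (ht 0).2 rfl]) hd ?_
    simpa using haltsWith_copy w hd t (o ++ [b])
  | succ h ih =>
    have h0 : t (h + 1) ≠ none := by simp [ht]
    refine .of_act (q' := .esc) (adv := false) (m := .left) (c := t (h + 1)) (x := some a)
      (by simp [table, innerTable, wallTable, h0]) (by simp only [apply_left]; omega) ?_
    simpa [List.replicate_succ] using ih (by omega) (o ++ [a])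

theorem haltsWith_escape {q : Mode} (w : List A) {h : ℕ} (hd : h ≤ d.length)
    {t : ℕ → Option (Option B)} (ht : ∀ i, t i = none ↔ i = 0) (o : List A)
    (hq : table a b e d.length h (t h) q w.head? = act .esc false .stay (t h) (some b)) :
    HaltsWith a b e d (conf a b e q w h t o) (o ++ escape a b h w) := by
  refine .of_act hq hd ?_
  simpa [escape, HeadMove.apply] using haltsWith_esc w hd ht (o ++ [b])

theorem haltsWith_skip {w : List A} {h : ℕ} (hd : h ≤ d.length) {t : ℕ → Option (Option B)}
    {o r : List A} {f : ℕ} (hf : h + f = d.length)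
    (H : HaltsWith a b e d (conf a b e .cmd w (skipFrom t f h) t o) r) :
    HaltsWith a b e d (conf a b e .skip w h t o) r := by
  induction f generalizing h with
  | zero =>
    refine .of_act (q' := .cmd) (adv := false) (m := .stay) (c := t h) (x := none)
      (by simp [table, wallTable, show ¬ h < d.length by omega]) hd ?_
    simpa [skipFrom] using H
  | succ f ih =>
    rw [skipFrom] at H
    have hlt : h < d.length := by omega
    split_ifs at H with hs
    · refine .of_act (q' := .skip) (adv := false) (m := .right) (c := t h) (x := none)
        (by simp [table, innerTable, hlt, hs]) (by simp only [apply_right]; omega) ?_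
      simpa using ih (by omega) (by omega) H
    · refine .of_act (q' := .cmd) (adv := false) (m := .stay) (c := t h) (x := none)
        (by simp [table, innerTable, hlt, hs]) hd ?_
      simpa using H

theorem haltsWith_scan {w : List A} {h : ℕ} (hd : h ≤ d.length) {t : ℕ → Option (Option B)}
    {o r : List A} {f : ℕ} (hf : h + f = d.length)
    (H : HaltsWith a b e d
      (conf a b e .home w d.length t (o ++ (List.replicate f a ++ [b]))) r) :
    HaltsWith a b e d (conf a b e .scan w h t o) r := by
  induction f generalizing h o with
  | zero =>
    refine .of_act (q' := .home) (adv := false) (m := .stay) (c := t h) (x := some b)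
      (by simp [table, wallTable, show ¬ h < d.length by omega]) hd ?_
    simpa [← hf] using H
  | succ f ih =>
    refine .of_act (q' := .scan) (adv := false) (m := .right) (c := t h) (x := some a)
      (by simp [table, innerTable, show h < d.length by omega]) (by simp only [apply_right]; omega) ?_
    simpa using ih (h := h + 1) (by omega) (by omega) (by simpa [List.replicate_succ] using H)

/-- The modes in which the next symbol of the input is decisive. -/
inductive Mode.IsMain : Mode → Prop
  | cmd : IsMain .cmd
  | read : IsMain .read
  | write : IsMain .write

/-- Induction on the input, with the auxiliary loops supplied by the lemmas above. The hypothesis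
`h0` keeps writing away from cell `0`, whose end mark stops the modes `home` and `esc`. -/
theorem haltsWith_enc (w : List A) {q : Mode} (hq : q.IsMain) {h : ℕ} (hd : h ≤ d.length)
    (h0 : q ≠ .cmd → h ≠ 0)
    {t : ℕ → Option (Option B)} (ht : ∀ i, t i = none ↔ i = 0) (o : List A) :
    HaltsWith a b e d (conf a b e q w h t o) (o ++ enc a b e d.length q t h w) := by
  induction w generalizing q h t o with
  | nil =>
    cases hq with
    | cmd =>
      by_cases hlt : h < d.length
      · simpa [enc] using HaltsWith.of_table_none (w := ([] : List A)) (o := o) (t := t)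
          (by simp [table, hlt, innerTable])
      · refine .of_act (q' := .copy) (adv := false) (m := .stay) (c := t h) (x := none)
          (by simp [table, hlt, wallTable]) hd ?_
        simpa [enc] using haltsWith_copy [] hd t o
    | read =>
      by_cases hlt : h < d.length ∧ (t h).join = none
      · refine .of_act (q' := .flag) (adv := false) (m := .stay) (c := t h) (x := some a)
          (by simp [table, hlt, innerTable]) hd ?_
        simpa [enc, hlt] using HaltsWith.of_table_none (w := ([] : List A)) (o := o ++ [a]) (t := t)
          (by simp [table, hlt, innerTable])
      · rw [enc, if_neg hlt]
        refine haltsWith_escape [] hd ht o ?_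
        by_cases hlt' : h < d.length
        · obtain ⟨y, hy⟩ := Option.ne_none_iff_exists'.1 fun h => hlt ⟨hlt', h⟩
          simp [table, hlt', innerTable, hy]
        · simp [table, hlt', wallTable]
    | write =>
      by_cases hlt : h < d.length
      · simpa [enc] using HaltsWith.of_table_none (w := ([] : List A)) (o := o) (t := t)
          (by simp [table, hlt, innerTable])
      · refine .of_act (q' := .copy) (adv := false) (m := .stay) (c := t h) (x := none)
          (by simp [table, hlt, wallTable]) hd ?_
        simpa [enc] using haltsWith_copy [] hd t o
  | cons s w ih =>
    cases hq with
    | cmd =>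
      by_cases hlt : h < d.length
      · refine .of_act (q' := if s = a then .read else .skip) (adv := true) (m := .right)
          (c := t h) (x := some s) (by simp [table, hlt, innerTable]) hlt ?_
        by_cases hs : s = a
        · simpa [enc, hlt, hs] using ih .read (h := h + 1) hlt (by simp) ht (o ++ [s])
        · have := haltsWith_skip (h := h + 1) hlt (f := d.length - (h + 1)) (by omega)
            (ih .cmd (h := skipFrom t (d.length - (h + 1)) (h + 1))
              ((skipFrom_le _ _ _).trans (by omega)) (by simp) ht (o ++ [s]))
          simpa [enc, hlt, hs] using this
      · refine .of_act (q' := .copy) (adv := false) (m := .stay) (c := t h) (x := none)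
          (by simp [table, hlt, wallTable]) hd ?_
        simpa [enc, hlt] using haltsWith_copy (s :: w) hd t o
    | read =>
      by_cases hlt : h < d.length
      · rw [enc, if_pos hlt]
        cases hy : (t h).join with
        | none =>
          refine .of_act (q' := .flag) (adv := false) (m := .stay) (c := t h) (x := some a)
            (by simp [table, hlt, innerTable, hy]) hd ?_
          refine .of_act (q' := if s = a then .home else .write) (adv := true) (m := .stay)
            (c := t h) (x := some s) (by simp [table, hlt, innerTable]) hd ?_
          by_cases hs : s = a
          · have := haltsWith_home hd ht
              (ih .cmd (h := 0) (by omega) (by simp) ht (o ++ [a] ++ [s]))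
            simpa [hs] using this
          · simpa [hs] using ih .write (h := h) hd (fun _ => h0 (by simp)) ht (o ++ [a] ++ [s])
        | some y =>
          by_cases hs : e s = y
          · refine .of_act (q' := .read) (adv := true) (m := .right) (c := t h) (x := none)
              (by simp [table, hlt, innerTable, hy, hs]) hlt ?_
            simpa [hs] using ih .read (h := h + 1) hlt (by simp) ht o
          · simp only [hs, if_false]
            exact haltsWith_escape _ hd ht o (by simp [table, hlt, innerTable, hy, hs])
      · rw [enc, if_neg hlt]
        exact haltsWith_escape _ hd ht o (by simp [table, hlt, wallTable])
    | write =>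
      by_cases hlt : h < d.length
      · refine .of_act (q' := .read) (adv := true) (m := .right) (c := some (some (e s)))
          (x := some s) (by simp [table, hlt, innerTable]) hlt ?_
        have ht' : ∀ i, Function.update t h (some (some (e s))) i = none ↔ i = 0 := by
          intro i
          by_cases hi : i = h
          · subst hi
            simpa using h0 (by simp)
          · rw [Function.update_of_ne hi, ht]
        simpa [enc, hlt] using ih .read (h := h + 1) hlt (by simp) ht' (o ++ [s])
      · refine .of_act (q' := .copy) (adv := false) (m := .stay) (c := t h) (x := none)
          (by simp [table, hlt, wallTable]) hd ?_
        simpa [enc, hlt] using haltsWith_copy (s :: w) hd t o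

theorem length_lengthTape (n : ℕ) : (OnlineTM.lengthTape n).length = n.size := by
  simp [OnlineTM.lengthTape, Nat.size_eq_bits_len]

theorem machine_outputs (w : List A) : (machine a b e).Outputs w (compress a b e w) := by
  have key : HaltsWith a b e (OnlineTM.lengthTape w.length)
      (conf a b e .init w 0 (fun _ => some none) []) (compress a b e w) := by
    refine .of_act (q' := .scan) (adv := false) (m := .stay) (c := none) (x := none)
      (by simp [table, innerTable, wallTable]) (by simp) ?_
    refine haltsWith_scan (Nat.zero_le _) (Nat.zero_add _) ?_
    refine haltsWith_home le_rfl startTape_eq_none_iff ?_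
    have := haltsWith_enc (a := a) (b := b) (e := e) (d := OnlineTM.lengthTape w.length) w .cmd
      (h := 0) (Nat.zero_le _) (by simp) startTape_eq_none_iff
      (List.replicate w.length.size a ++ [b])
    simpa [compress, length_lengthTape] using this
  exact key

/-- Invariant: both heads are at the same position, at most the number of digits of the input
length. -/
theorem machine_spaceWithin (w : List A) :
    (machine a b e).SpaceWithin w (Nat.log 2 w.length + 2) := by
  have key : ∀ s : (machine a b e).Config, (machine a b e).Reaches w s →
      (∃ q v h t o, s = conf a b e q v h t o ∧ h ≤ w.length.size) := by
    intro s hs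
    induction hs with
    | refl => exact ⟨.init, w, 0, _, [], rfl, Nat.zero_le _⟩
    | tail _ hstep ih =>
      obtain ⟨q, v, h, t, o, rfl, hh⟩ := ih
      change (machine a b e).step _ _ = some _ at hstep
      rw [step_conf] at hstep
      obtain ⟨r, hr, rfl⟩ := Option.map_eq_some_iff.1 hstep
      obtain ⟨h1, h2⟩ := table_moves hr
      rw [length_lengthTape] at h2 ⊢
      have hle : r.lenMove.apply h ≤ w.length.size := by
        cases hm : r.lenMove with
        | left => rw [apply_left]; omega
        | stay => exact hh
        | right => exact h2 hm
      refine ⟨r.state, if r.advance then v.tail else v, r.lenMove.apply h,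
        Function.update t h (r.write ()), o ++ r.emit.toList, ?_, hle⟩
      simp only [conf, min_eq_left hle]
      congr 1
      funext k
      exact congrArg (HeadMove.apply · h) (h1 k)
  intro s hs k
  obtain ⟨q, v, h, t, o, rfl, hh⟩ := key s hs
  change h < _
  have : w.length.size ≤ Nat.log 2 w.length + 1 :=
    Nat.size_le.2 (Nat.lt_pow_succ_log_self one_lt_two _)
  omega

theorem isPlogon_compress (a b : A) (e : A → B) : IsPlogon (compress a b e) :=
  ⟨machine a b e, machine_outputs, 1, fun w => by simpa using machine_spaceWithin w⟩

end

/-! ### Injectivity and output length of the encoder -/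

section

variable {A : Type u} {B : Type} [DecidableEq A] [DecidableEq B] {a b : A} {e : A → B}

theorem enc_read_wall {D h : ℕ} (hlt : ¬ h < D) (t : ℕ → Option (Option B)) (w : List A) :
    enc a b e D .read t h w = escape a b h w := by
  cases w <;> simp [enc, hlt]

theorem enc_read_blank_nil {D h : ℕ} (hlt : h < D) {t : ℕ → Option (Option B)}
    (hy : (t h).join = none) : enc a b e D .read t h [] = [a] := by
  simp [enc, hlt, hy]

theorem enc_read_blank_cons {D h : ℕ} (hlt : h < D) {t : ℕ → Option (Option B)}
    (hy : (t h).join = none) (s : A) (w : List A) :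
    enc a b e D .read t h (s :: w) =
      a :: s :: (if s = a then enc a b e D .cmd t 0 w else enc a b e D .write t h w) := by
  simp [enc, hlt, hy]

theorem enc_read_match {D h : ℕ} (hlt : h < D) {t : ℕ → Option (Option B)} {s : A}
    (hy : (t h).join = some (e s)) (w : List A) :
    enc a b e D .read t h (s :: w) = enc a b e D .read t (h + 1) w := by
  simp [enc, hlt, hy]

theorem enc_read_mismatch {D h : ℕ} (hlt : h < D) {t : ℕ → Option (Option B)} {x : B}
    (hy : (t h).join = some x) {w : List A} (hw : w.head?.map e ≠ some x) :
    enc a b e D .read t h w = escape a b h w := by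
  cases w with
  | nil => simp [enc, hy]
  | cons s w => simp only [enc, hlt, hy, if_true]; exact if_neg (by simpa using hw)

/-- Case distinction for the first step in the mode `read`. -/
theorem enc_read_cases (a b : A) (e : A → B) (D : ℕ) (t : ℕ → Option (Option B)) (h : ℕ)
    (w : List A) :
    (enc a b e D .read t h w = escape a b h w) ∨
    (h < D ∧ (t h).join = none) ∨
    (h < D ∧ ∃ s v, w = s :: v ∧ (t h).join = some (e s) ∧
      enc a b e D .read t h w = enc a b e D .read t (h + 1) v) := by
  by_cases hlt : h < D
  · cases hy : (t h).join with
    | none => exact .inr (.inl ⟨hlt, rfl⟩)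
    | some x =>
      by_cases hw : w.head?.map e = some x
      · cases w with
        | nil => simp at hw
        | cons s v =>
          obtain rfl : e s = x := by simpa using hw
          exact .inr (.inr ⟨hlt, s, v, rfl, rfl, enc_read_match hlt hy v⟩)
      · exact .inl (enc_read_mismatch hlt hy hw)
  · exact .inl (enc_read_wall hlt t w)

/-- Matched symbols emit nothing, so the first output after a match tells how it ended: `a` at a
blank, otherwise `b` and the final cell in unary. -/
theorem enc_read_shape (D : ℕ) (t : ℕ → Option (Option B)) (h : ℕ) (w : List A) :
    (∃ r, enc a b e D .read t h w = a :: r) ∨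
      ∃ h' ≥ h, ∃ r, enc a b e D .read t h w = b :: (List.replicate h' a ++ b :: r) := by
  induction w generalizing h with
  | nil =>
    obtain h1 | ⟨h1, h2⟩ | ⟨_, _, _, h1, _⟩ := enc_read_cases a b e D t h []
    · exact .inr ⟨h, le_rfl, _, h1⟩
    · exact .inl ⟨_, enc_read_blank_nil h1 h2⟩
    · cases h1
  | cons s w ih =>
    obtain h1 | ⟨h1, h2⟩ | ⟨_, _, _, h1, _, h2⟩ := enc_read_cases a b e D t h (s :: w)
    · exact .inr ⟨h, le_rfl, _, h1⟩
    · exact .inl ⟨_, enc_read_blank_cons h1 h2 _ _⟩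
    · cases h1
      rw [h2]
      exact (ih (h + 1)).imp_right fun ⟨h', h1, h2⟩ => ⟨h', by omega, h2⟩

/-- An escape records its cell, so stopping at `h` cannot be confused with matching beyond `h`. -/
theorem escape_ne_enc_read (hab : a ≠ b) {D : ℕ} {t : ℕ → Option (Option B)} {h h' : ℕ}
    (hh : h < h') (v w : List A) : escape a b h v ≠ enc a b e D .read t h' w := by
  intro H
  obtain ⟨r, h1⟩ | ⟨k, hk, r, h1⟩ := enc_read_shape (a := a) (b := b) (e := e) D t h' w
  · rw [h1, escape] at H
    simp [hab.symm] at H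
  · rw [h1, escape, List.cons.injEq] at H
    have := (replicate_append_cons_inj hab H.2).1
    omega

/-- A decoder can follow mode, tape and head. The symbols swallowed by a match stand on the tape,
and the output shows where the match stopped. -/
theorem enc_injective (hab : a ≠ b) (he : Function.Injective e) (D : ℕ) {q : Mode} (hq : q.IsMain)
    (t : ℕ → Option (Option B)) (h : ℕ) : Function.Injective (enc a b e D q t h) := by
  -- The end of the input needs care: at a blank it emits a single `a`, where a further symbol would
  -- be emitted too; otherwise it gives an escape with empty rest.
  have read_nil : ∀ (h : ℕ) (t : ℕ → Option (Option B)) (w : List A),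
      enc a b e D .read t h [] = enc a b e D .read t h w → w = [] := by
    intro h t w H
    obtain h1 | ⟨h1, h2⟩ | ⟨_, _, _, h1, _⟩ := enc_read_cases a b e D t h []
    · obtain h2 | ⟨h2, h3⟩ | ⟨h2, s, v, rfl, -, h3⟩ := enc_read_cases a b e D t h w
      · exact (escape_inj hab (h1.symm.trans (H.trans h2))).symm
      · rw [enc_read_blank_nil h2 h3, escape, List.cons.injEq] at h1
        exact absurd h1.1 hab
      · exact absurd (h1.symm.trans (H.trans h3))
          (escape_ne_enc_read hab (Nat.lt_succ_self h) _ _)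
    · cases w with
      | nil => rfl
      | cons s w => simp [enc_read_blank_nil h1 h2, enc_read_blank_cons h1 h2] at H
    · cases h1
  intro v
  induction v generalizing q t h with
  | nil =>
    intro w H
    cases hq with
    | cmd =>
      cases w with
      | nil => rfl
      | cons s w => rw [enc, enc] at H; split_ifs at H
    | write =>
      cases w with
      | nil => rfl
      | cons s w => rw [enc, enc] at H; split_ifs at H
    | read => exact (read_nil h t w H).symm
  | cons s v ih =>
    intro w H
    cases hq with
    | cmd =>
      cases w with
      | nil => rw [enc, enc] at H; split_ifs at H
      | cons r w =>
        rw [enc, enc] at H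
        split_ifs at H with hlt h1 h2 h2
        · simp only [List.cons.injEq] at H
          rw [H.1, ih .read _ _ H.2]
        · simp only [List.cons.injEq] at H
          exact absurd (H.1.symm.trans h1) h2
        · simp only [List.cons.injEq] at H
          exact absurd (H.1.trans h2) h1
        · simp only [List.cons.injEq] at H
          rw [H.1, ih .cmd _ _ H.2]
        · exact H
    | write =>
      cases w with
      | nil => rw [enc, enc] at H; split_ifs at H
      | cons r w =>
        rw [enc, enc] at H
        split_ifs at H with hlt
        · simp only [List.cons.injEq] at H
          obtain ⟨rfl, H⟩ := H
          rw [ih .read _ _ H]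
        · exact H
    | read =>
      cases w with
      | nil => exact read_nil h t _ H.symm
      | cons r w =>
        have blank : h < D → (t h).join = none → s :: v = r :: w := by
          intro h1 h2
          rw [enc_read_blank_cons h1 h2, enc_read_blank_cons h1 h2] at H
          simp only [List.cons.injEq, true_and] at H
          obtain ⟨rfl, H⟩ := H
          split_ifs at H
          · rw [ih .cmd _ _ H]
          · rw [ih .write _ _ H]
        obtain h1 | ⟨h1, h2⟩ | ⟨_, _, _, h1, h1', h2⟩ := enc_read_cases a b e D t h (s :: v)
        · obtain h3 | ⟨h3, h4⟩ | ⟨_, _, _, h3, -, h4⟩ := enc_read_cases a b e D t h (r :: w)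
          · exact escape_inj hab (h1.symm.trans (H.trans h3))
          · exact blank h3 h4
          · exact absurd (h1.symm.trans (H.trans h4))
              (escape_ne_enc_read hab (Nat.lt_succ_self h) _ _)
        · exact blank h1 h2
        · cases h1
          obtain h3 | ⟨h3, h4⟩ | ⟨_, _, _, h3, h3', h4⟩ := enc_read_cases a b e D t h (r :: w)
          · exact absurd (h3.symm.trans (H.symm.trans h2))
              (escape_ne_enc_read hab (Nat.lt_succ_self h) _ _)
          · exact blank h3 h4
          · cases h3
            rw [ih .read _ _ (h2.symm.trans (H.trans h4)),
              he (Option.some_injective _ (h1'.symm.trans h3'))]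

theorem compress_injective (hab : a ≠ b) (he : Function.Injective e) :
    Function.Injective (compress a b e) := by
  intro v w H
  rw [compress, compress] at H
  obtain ⟨h1, h2⟩ := replicate_append_cons_inj hab H
  rw [h1] at h2
  exact enc_injective hab he _ .cmd _ _ h2

theorem isILplog_compress [Finite B] (hab : a ≠ b) (he : Function.Injective e) :
    IsILplog (compress a b e) :=
  ⟨isPlogon_compress a b e, compress_injective hab he⟩

/-- A symbol read at a blank costs two output symbols; an escape or the end of the input occurs once
and adds at most `D + 2`. The bound serves for an incomplete last block. -/
theorem length_enc_le (D : ℕ) {q : Mode} (hq : q.IsMain) (t : ℕ → Option (Option B)) {h : ℕ}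
    (hh : h ≤ D) (w : List A) : (enc a b e D q t h w).length ≤ 2 * w.length + D + 2 := by
  induction w generalizing q t h with
  | nil =>
    cases hq with
    | cmd => simp [enc]
    | write => simp [enc]
    | read =>
      rw [enc]
      split_ifs
      · simp
      · rw [length_escape]; simp; omega
  | cons s w ih =>
    rw [List.length_cons]
    cases hq with
    | cmd =>
      rw [enc]
      split_ifs with h1 h2
      · have := ih .read t (h := h + 1) h1
        rw [List.length_cons]; omega
      · have := ih .cmd t (h := skipFrom t (D - (h + 1)) (h + 1))
          ((skipFrom_le _ _ _).trans (by omega))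
        rw [List.length_cons]; omega
      · rw [List.length_cons]; omega
    | write =>
      rw [enc]
      split_ifs with h1
      · have := ih .read (Function.update t h (some (some (e s)))) (h := h + 1) h1
        rw [List.length_cons]; omega
      · rw [List.length_cons]; omega
    | read =>
      obtain h1 | ⟨h1, h2⟩ | ⟨h0, _, _, h1, -, h2⟩ := enc_read_cases a b e D t h (s :: w)
      · rw [h1, length_escape, List.length_cons]; omega
      · rw [enc_read_blank_cons h1 h2, List.length_cons, List.length_cons]
        split_ifs
        · have := ih .cmd t (Nat.zero_le D)
          omega
        · have := ih .write t hh
          omega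
      · cases h1
        have := ih .read t (h := h + 1) h0
        rw [h2]; omega

end

end DictCompressor

/-! ### Pushdown compressors -/

namespace PushdownCompressor

/-! ### Locality: only the top of the stack matters for a while -/

section

variable {A : Type u} {B : Type v} (C : PushdownCompressor A B)

/-- The extended transition function from an arbitrary configuration. -/
def runFrom (s : Option (C.Q × List C.Γ)) (w : List A) : Option (C.Q × List C.Γ) :=
  w.foldl C.next s

theorem run_append (v w : List A) : C.run (v ++ w) = C.runFrom (C.run v) w := by
  simp [run, runFrom]

theorem outputFrom_append (s : Option (C.Q × List C.Γ)) (v w : List A) :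
    C.outputFrom s (v ++ w) =
      (C.outputFrom s v).bind fun o => (C.outputFrom (C.runFrom s v) w).map fun o' => o ++ o' := by
  induction v generalizing s with
  | nil =>
    simp only [List.nil_append, outputFrom, runFrom, List.foldl_nil, Option.bind_some]
    cases C.outputFrom s w <;> simp
  | cons b v ih =>
    cases s with
    | none => simp [outputFrom]
    | some t =>
      obtain ⟨q, _ | ⟨a, y⟩⟩ := t
      · simp [outputFrom]
      · simp only [List.cons_append, outputFrom, Option.bind_some, List.head?_cons, ih, runFrom,
          List.foldl_cons]
        cases C.outputFrom (C.next (some (q, a :: y)) b) v with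
        | none => simp
        | some o =>
          cases C.outputFrom (List.foldl C.next (C.next (some (q, a :: y)) b) v) w <;> simp

theorem output_append (v w : List A) :
    C.output (v ++ w) =
      (C.output v).bind fun o => (C.outputFrom (C.run v) w).map fun o' => o ++ o' :=
  C.outputFrom_append _ v w

/-- At most `c` symbols are popped, and the test that stops the popping looks at one more symbol,
hence `c < n`. -/
theorem lambdaClosure_take {q : C.Q} {y y' : List C.Γ} {n c : ℕ} (h : y.take n = y'.take n)
    (hc : C.lambdaCount q y ≤ c) (hn : c < n) :
    (C.lambdaClosure q y).1 = (C.lambdaClosure q y').1 ∧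
      (C.lambdaClosure q y).2.take (n - c) = (C.lambdaClosure q y').2.take (n - c) := by
  induction y generalizing q y' n c with
  | nil =>
    obtain ⟨n, rfl⟩ := Nat.exists_eq_succ_of_ne_zero (by omega : n ≠ 0)
    cases y' with
    | nil => simp
    | cons a y' => simp at h
  | cons a y ih =>
    obtain ⟨n, rfl⟩ := Nat.exists_eq_succ_of_ne_zero (by omega : n ≠ 0)
    cases y' with
    | nil => simp at h
    | cons a' y' =>
      simp only [List.take_succ_cons, List.cons.injEq] at h
      obtain ⟨rfl, h⟩ := h
      rw [lambdaCount] at hc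
      rw [lambdaClosure, lambdaClosure]
      cases hδ : C.δ q none a with
      | none =>
        refine ⟨rfl, ?_⟩
        dsimp only
        obtain ⟨m, hm⟩ : ∃ m, n + 1 - c = m + 1 := ⟨n - c, by omega⟩
        rw [Nat.succ_eq_add_one, hm, List.take_succ_cons, List.take_succ_cons]
        have : m ≤ n := by omega
        rw [← min_eq_left this, ← List.take_take, h, List.take_take]
      | some p =>
        rw [hδ] at hc
        dsimp only at hc ⊢
        obtain ⟨c, rfl⟩ := Nat.exists_eq_succ_of_ne_zero (by omega : c ≠ 0)
        simpa using ih h (by omega : C.lambdaCount p.1 y ≤ c) (by omega)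

/-- Along the words read from the configuration `s`, at most `k` `λ`-rules are applied after each
symbol. -/
def BoundedFrom (k : ℕ) (s : Option (C.Q × List C.Γ)) : Prop :=
  ∀ (w : List A) (b : A) (r t : C.Q × List C.Γ),
    C.runFrom s w = some r → C.readSymbol b r = some t → C.lambdaCount t.1 t.2 ≤ k

variable {C}

theorem IsBounded.boundedFrom (h : C.IsBounded) (w : List A) :
    C.BoundedFrom C.c (C.run w) := by
  intro v b r t hr ht
  exact h (w ++ v) b r t (by rw [run_append, hr]) ht

theorem BoundedFrom.next {k : ℕ} {s : Option (C.Q × List C.Γ)} (h : C.BoundedFrom k s) (b : A) :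
    C.BoundedFrom k (C.next s b) :=
  fun w => h (b :: w)

/-- An input symbol uncovers at most `k + 1` stack symbols: one by its own transition and `k` by
`λ`-rules. Boundedness is needed for one stack only, since the other run imitates it. -/
theorem outputFrom_eq_of_take {k : ℕ} {w : List A} {q : C.Q} {y y' : List C.Γ} {n : ℕ}
    (hb : C.BoundedFrom k (some (q, y))) (h : y.take n = y'.take n)
    (hn : (k + 1) * w.length < n) :
    C.outputFrom (some (q, y)) w = C.outputFrom (some (q, y')) w := by
  induction w generalizing q y y' n with
  | nil => rfl
  | cons b w ih =>
    rw [List.length_cons, Nat.mul_succ] at hn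
    obtain ⟨n, rfl⟩ := Nat.exists_eq_succ_of_ne_zero (by omega : n ≠ 0)
    cases y with
    | nil =>
      cases y' with
      | nil => rfl
      | cons a y' => simp at h
    | cons a y =>
      cases y' with
      | nil => simp at h
      | cons a' y' =>
        have h' := h
        simp only [List.take_succ_cons, List.cons.injEq] at h
        obtain ⟨rfl, h⟩ := h
        simp only [outputFrom, Option.bind_some, List.head?_cons]
        suffices H : C.outputFrom (C.next (some (q, a :: y)) b) w =
            C.outputFrom (C.next (some (q, a :: y')) b) w by rw [H]
        have hb' := hb.next b
        simp only [next, Option.bind_some, readSymbol] at hb' ⊢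
        cases hδ : C.δ q (some b) a with
        | none => simp
        | some p =>
          have hcount := hb [] b (q, a :: y) (p.1, p.2 ++ y) rfl (by simp [readSymbol, hδ])
          simp only [hδ, Option.map_some] at hb' ⊢
          have htake : (p.2 ++ y).take n = (p.2 ++ y').take n := by
            rw [List.take_append, List.take_append]
            congr 1
            have : n - p.2.length ≤ n := by omega
            rw [← min_eq_left this, ← List.take_take, h, List.take_take]
          obtain ⟨h1, h2⟩ := C.lambdaClosure_take htake hcount (by omega)
          have := ih (q := (C.lambdaClosure p.1 (p.2 ++ y)).1) hb' h2 (by omega)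
          have h3 : C.lambdaClosure p.1 (p.2 ++ y') =
              ((C.lambdaClosure p.1 (p.2 ++ y)).1, (C.lambdaClosure p.1 (p.2 ++ y')).2) :=
            Prod.ext h1.symm rfl
          rw [h3]
          exact this

end

/-! ### Output before the endmarker -/

section

variable {A : Type u} (C : PushdownCompressor (Option A) A)

/-- The length of the output on a word without endmarker. -/
def outputLength (w : List A) : ℕ :=
  ((C.output (w.map some)).getD []).length

variable {C}

/-- The endmarker contributes a word determined by the final state and top symbol, so beyond the
outputs on `u` and `w` only finitely much information is left. -/
theorem IsILPDCwE.exists_output (h : C.IsILPDCwE) (u w : List A) :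
    ∃ o o' p q a y, C.output (u.map some) = some o ∧
      C.outputFrom (C.run (u.map some)) (w.map some) = some o' ∧
      C.run ((u ++ w).map some) = some (q, a :: y) ∧ C.output (withEnd (u ++ w)) = some p ∧
      p = o ++ o' ++ C.ν q none a := by
  obtain ⟨p, hp⟩ := Option.isSome_iff_exists.1 (h.2.1 (u ++ w)).1
  have hp' := hp
  rw [withEnd, output_append] at hp'
  obtain ⟨o₁, h1, hp'⟩ := Option.bind_eq_some_iff.1 hp'
  obtain ⟨o₂, h2, hp'⟩ := Option.map_eq_some_iff.1 hp'
  rw [List.map_append, output_append] at h1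
  obtain ⟨o, h3, h1⟩ := Option.bind_eq_some_iff.1 h1
  obtain ⟨o', h4, h1⟩ := Option.map_eq_some_iff.1 h1
  rw [outputFrom] at h2
  obtain ⟨⟨q, y⟩, h5, h2⟩ := Option.bind_eq_some_iff.1 h2
  obtain ⟨a, h6, h2⟩ := Option.bind_eq_some_iff.1 h2
  obtain ⟨y, rfl⟩ : ∃ y', y = a :: y' := by
    cases y with
    | nil => simp at h6
    | cons a' y => simp at h6; exact ⟨y, by rw [h6]⟩
  refine ⟨o, o', p, q, a, y, h3, h4, h5, hp, ?_⟩
  rw [outputFrom] at h2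
  obtain rfl : C.ν q none a = o₂ := by simpa using h2
  rw [← hp', ← h1]

theorem outputLength_append (h : C.IsILPDCwE) (u w : List A) :
    C.outputLength (u ++ w) = C.outputLength u +
      ((C.outputFrom (C.run (u.map some)) (w.map some)).getD []).length := by
  obtain ⟨o, o', p, q, a, y, h1, h2, -⟩ := h.exists_output u w
  simp [outputLength, output_append, h1, h2]

/-- Lower bounds go through `outputLength` because it is monotone in the prefix, which the output
with endmarker need not be. -/
theorem outputLength_le_endOutput (h : C.IsILPDCwE) (w : List A) :
    C.outputLength w ≤ (C.endOutput w).length := by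
  obtain ⟨o, o', p, q, a, y, h1, h2, h3, h4, h5⟩ := h.exists_output w []
  rw [List.append_nil] at h4
  simp only [outputLength, endOutput, h1, h4, h5, Option.getD_some, List.length_append]
  omega

end

/-! ### Countably many compressors up to renaming -/

section

variable {A : Type u} {B : Type v} (C : PushdownCompressor A B)

/-- The compressor with renamed states and stack symbols. -/
def relabel {Q' Γ' : Type} (eQ : C.Q ≃ Q') (eΓ : C.Γ ≃ Γ') : PushdownCompressor A B where
  Q := Q'
  Γ := Γ'
  finite_Q := have := C.finite_Q; .of_equiv _ eQ
  finite_Γ := have := C.finite_Γ; .of_equiv _ eΓ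
  δ q b a := (C.δ (eQ.symm q) b (eΓ.symm a)).map (Prod.map eQ (List.map eΓ))
  ν q b a := C.ν (eQ.symm q) b (eΓ.symm a)
  q₀ := eQ C.q₀
  z₀ := eΓ C.z₀
  -- The constant does not influence the output; fixing it leaves a compressor determined by its
  -- tables and start data.
  c := 0
  bottom q b p h := by
    rw [Equiv.symm_apply_apply] at h
    obtain ⟨p', h', rfl⟩ := Option.map_eq_some_iff.1 h
    obtain ⟨v, hv⟩ := C.bottom _ _ _ h'
    exact ⟨v.map eΓ, by simp [hv]⟩
  lambda_pops q a p h := by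
    obtain ⟨p', h', rfl⟩ := Option.map_eq_some_iff.1 h
    simp [C.lambda_pops _ _ _ h']
  deterministic q a := by
    simpa using C.deterministic (eQ.symm q) (eΓ.symm a)

end

/-- Renaming the states by `f` and the stack symbols by `g` turns `C` into `R`. -/
structure IsRenaming {A : Type u} {B : Type v} (C R : PushdownCompressor A B) (f : C.Q → R.Q)
    (g : C.Γ → R.Γ) : Prop where
  δ_eq : ∀ q b a, R.δ (f q) b (g a) = (C.δ q b a).map (Prod.map f (List.map g))
  ν_eq : ∀ q b a, R.ν (f q) b (g a) = C.ν q b a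
  q₀_eq : R.q₀ = f C.q₀
  z₀_eq : R.z₀ = g C.z₀

namespace IsRenaming

variable {A : Type u} {B : Type v} {C R : PushdownCompressor A B} {f : C.Q → R.Q} {g : C.Γ → R.Γ}

theorem lambdaClosure_eq (h : IsRenaming C R f g) (q : C.Q) (y : List C.Γ) :
    R.lambdaClosure (f q) (y.map g) = Prod.map f (List.map g) (C.lambdaClosure q y) := by
  induction y generalizing q with
  | nil => rfl
  | cons a y ih =>
    rw [List.map_cons, lambdaClosure, lambdaClosure, h.δ_eq]
    cases C.δ q none a with
    | none => rfl
    | some p => exact ih p.1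

theorem next_eq (h : IsRenaming C R f g) (s : Option (C.Q × List C.Γ)) (b : A) :
    R.next (s.map (Prod.map f (List.map g))) b = (C.next s b).map (Prod.map f (List.map g)) := by
  obtain _ | ⟨q, _ | ⟨a, y⟩⟩ := s
  · rfl
  · rfl
  · simp only [next, Option.map_some, Option.bind_some, Prod.map_apply, List.map_cons, readSymbol,
      h.δ_eq]
    cases C.δ q (some b) a with
    | none => rfl
    | some p =>
      have := h.lambdaClosure_eq p.1 (p.2 ++ y)
      simpa using this

theorem outputFrom_eq (h : IsRenaming C R f g) (s : Option (C.Q × List C.Γ)) (w : List A) :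
    R.outputFrom (s.map (Prod.map f (List.map g))) w = C.outputFrom s w := by
  induction w generalizing s with
  | nil => rfl
  | cons b w ih =>
    obtain _ | ⟨q, _ | ⟨a, y⟩⟩ := s
    · rfl
    · rfl
    · have h1 := ih (C.next (some (q, a :: y)) b)
      rw [← h.next_eq] at h1
      rw [outputFrom, outputFrom, h1]
      simp [h.ν_eq]

theorem output_eq (h : IsRenaming C R f g) (w : List A) : R.output w = C.output w := by
  have := h.outputFrom_eq (some (C.lambdaClosure C.q₀ [C.z₀])) w
  rw [Option.map_some, ← h.lambdaClosure_eq, List.map_singleton, ← h.q₀_eq, ← h.z₀_eq] at this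
  exact this

end IsRenaming

theorem relabel_output {A : Type u} {B : Type v} (C : PushdownCompressor A B) {Q' Γ' : Type}
    (eQ : C.Q ≃ Q') (eΓ : C.Γ ≃ Γ') (w : List A) :
    (C.relabel eQ eΓ).output w = C.output w :=
  IsRenaming.output_eq (f := eQ) (g := eΓ)
    ⟨fun q b a => by simp [relabel], fun q b a => by simp [relabel], rfl, rfl⟩ w

/-- Codes for compressors whose states and stack symbols are numbers. -/
abbrev Code (A : Type u) : Type u :=
  Σ n k : ℕ, (Fin n → Option (Option A) → Fin k → Option (Fin n × List (Fin k))) ×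
    (Fin n → Option A → Fin k → List A) × Fin n × Fin k

open Classical in
/-- The output length of the compressor with a given code. -/
noncomputable def codeOutputLength {A : Type u} (x : Code A) : List A → ℕ :=
  -- Any compressor with these data will do, since they determine the output; `0` is a junk value.
  if h : ∃ C : PushdownCompressor (Option A) A, ∃ (eQ : C.Q ≃ Fin x.1) (eΓ : C.Γ ≃ Fin x.2.1),
      (C.relabel eQ eΓ).δ = x.2.2.1 ∧ (C.relabel eQ eΓ).ν = x.2.2.2.1 ∧
      (C.relabel eQ eΓ).q₀ = x.2.2.2.2.1 ∧ (C.relabel eQ eΓ).z₀ = x.2.2.2.2.2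
  then h.choose.outputLength else 0

instance (A : Type u) [Finite A] : Countable (Code A) := by
  have (n k : ℕ) : Countable (Fin n → Option (Option A) → Fin k → Option (Fin n × List (Fin k))) :=
    inferInstance
  have (n k : ℕ) : Countable (Fin n → Option A → Fin k → List A) :=
    inferInstance
  infer_instance

/-- States and stack symbols may be any finite types, but they can be renamed to `Fin n` and `Fin
k`, and there are countably many tables over these. -/
theorem countable_outputLength (A : Type u) [Finite A] :
    (Set.range (outputLength : PushdownCompressor (Option A) A → List A → ℕ)).Countable := by
  refine (Set.countable_range (codeOutputLength (A := A))).mono ?_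
  rintro _ ⟨C, rfl⟩
  have := C.finite_Q
  have := C.finite_Γ
  obtain ⟨n, ⟨eQ⟩⟩ := Finite.exists_equiv_fin C.Q
  obtain ⟨k, ⟨eΓ⟩⟩ := Finite.exists_equiv_fin C.Γ
  refine ⟨⟨n, k, (C.relabel eQ eΓ).δ, (C.relabel eQ eΓ).ν, (C.relabel eQ eΓ).q₀,
    (C.relabel eQ eΓ).z₀⟩, ?_⟩
  have h : ∃ C' : PushdownCompressor (Option A) A, ∃ (eQ' : C'.Q ≃ Fin n) (eΓ' : C'.Γ ≃ Fin k),
      (C'.relabel eQ' eΓ').δ = (C.relabel eQ eΓ).δ ∧ (C'.relabel eQ' eΓ').ν = (C.relabel eQ eΓ).ν ∧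
      (C'.relabel eQ' eΓ').q₀ = (C.relabel eQ eΓ).q₀ ∧
      (C'.relabel eQ' eΓ').z₀ = (C.relabel eQ eΓ).z₀ := ⟨C, eQ, eΓ, rfl, rfl, rfl, rfl⟩
  rw [codeOutputLength, dif_pos h]
  obtain ⟨eQ', eΓ', h1, h2, h3, h4⟩ := h.choose_spec
  -- The types and `c` agree by construction, and the other fields not covered by `h1` to `h4` are
  -- proofs.
  have key : h.choose.relabel eQ' eΓ' = C.relabel eQ eΓ := by
    unfold relabel at h1 h2 h3 h4 ⊢
    dsimp only at h1 h2 h3 h4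
    congr 1
  funext w
  rw [outputLength, outputLength, ← relabel_output _ eQ' eΓ', key, relabel_output]

/-! ### Incompressible words -/

/-- A self-delimiting padding `a^j b` brings every shorter word to length exactly `k`. -/
theorem card_lists_lt {A : Type u} [Finite A] [Nontrivial A] (k : ℕ) :
    Finite {l : List A // l.length < k} ∧
      Nat.card {l : List A // l.length < k} ≤ Nat.card A ^ k := by
  obtain ⟨a, b, hab⟩ := exists_pair_ne A
  have := Fintype.ofFinite A
  let pad : {l : List A // l.length < k} → List.Vector A k := fun l =>
    ⟨List.replicate (k - 1 - l.1.length) a ++ b :: l.1, by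
      have := l.2
      simp only [List.length_append, List.length_replicate, List.length_cons]
      omega⟩
  have hpad : Function.Injective pad := fun l l' h =>
    Subtype.ext (DictCompressor.replicate_append_cons_inj hab (congrArg Subtype.val h)).2
  refine ⟨Finite.of_injective pad hpad, (Nat.card_le_card_of_injective pad hpad).trans ?_⟩
  rw [Nat.card_eq_fintype_card, Nat.card_eq_fintype_card, card_vector]

variable {A : Type u} {C : PushdownCompressor (Option A) A}

/-- Given `u`, the output on `x`, the final state and the top symbol determine `C(ux$)` and the
state, hence `x` by losslessness. -/
theorem IsILPDCwE.card_compressed_le [Finite A] [Nontrivial A] (h : C.IsILPDCwE) (u : List A) (L k : ℕ) :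
    Nat.card {x : Fin L → A // C.outputLength (u ++ List.ofFn x) - C.outputLength u < k} ≤
      Nat.card C.Q * Nat.card C.Γ * Nat.card A ^ k := by
  have := C.finite_Q
  have := C.finite_Γ
  have := (card_lists_lt (A := A) k).1
  choose o o' p q a y h1 h2 h3 h4 h5 using fun x : Fin L → A => h.exists_output u (List.ofFn x)
  let φ : {x : Fin L → A // C.outputLength (u ++ List.ofFn x) - C.outputLength u < k} →
      (C.Q × C.Γ) × {l : List A // l.length < k} := fun x =>
    ((q x.1, a x.1), ⟨o' x.1, by
      have := x.2
      rwa [outputLength_append h, Nat.add_sub_cancel_left, h2] at this⟩)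
  have hφ : Function.Injective φ := by
    intro x x' hx
    simp only [φ, Prod.mk.injEq, Subtype.mk.injEq] at hx
    obtain ⟨⟨hq, ha⟩, ho'⟩ := hx
    have ho : o x.1 = o x'.1 := Option.some_injective _ ((h1 x.1).symm.trans (h1 x'.1))
    have hw : u ++ List.ofFn x.1 = u ++ List.ofFn x'.1 := by
      apply h.2.2
      simp only [finalState, h3, h4, h5, ho, ho', hq, ha, Option.map_some]
    exact Subtype.ext (List.ofFn_injective (List.append_cancel_left hw))
  refine (Nat.card_le_card_of_injective φ hφ).trans ?_
  rw [Nat.card_prod, Nat.card_prod]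
  exact Nat.mul_le_mul_left _ (card_lists_lt k).2

/-- The type of `u` is its state with the top `(c + 1) * t + 1` stack symbols, `none` standing for a
cell below the bottom. The base `K` does not depend on `t`. -/
theorem IsILPDCwE.exists_types (h : C.IsILPDCwE) : ∃ K : ℕ, ∀ t, 1 ≤ t → ∃ τ : List A → ℕ,
    (∀ u, τ u < K ^ t) ∧ ∀ u u', τ u = τ u' → ∀ x : List A, x.length ≤ t →
      C.outputLength (u ++ x) - C.outputLength u = C.outputLength (u' ++ x) - C.outputLength u' := by
  have := C.finite_Q
  have := C.finite_Γ
  refine ⟨Nat.card C.Q * Nat.card (Option C.Γ) ^ (C.c + 2), fun t ht => ?_⟩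
  obtain ⟨n, ⟨e⟩⟩ := Finite.exists_equiv_fin (C.Q × (Fin ((C.c + 1) * t + 1) → Option C.Γ))
  have hrun : ∀ u : List A, ∃ s, C.run (u.map some) = some s := fun u =>
    Option.isSome_iff_exists.1 (by simpa [finalState] using (h.2.1 u).2)
  choose s hs using hrun
  refine ⟨fun u => e ((s u).1, fun i => (s u).2[i.1]?), fun u => ?_, fun u u' huu x hx => ?_⟩
  · refine (e _).2.trans_le ?_
    have hn : n = Nat.card C.Q * Nat.card (Option C.Γ) ^ ((C.c + 1) * t + 1) := by
      rw [← Nat.card_fin n, ← Nat.card_congr e, Nat.card_prod, Nat.card_fun, Nat.card_fin]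
    have hQ : 0 < Nat.card C.Q := Nat.card_pos_iff.2 ⟨⟨C.q₀⟩, inferInstance⟩
    have hΓ : 0 < Nat.card (Option C.Γ) := Nat.card_pos
    rw [hn, mul_pow, ← pow_mul]
    refine Nat.mul_le_mul (Nat.le_self_pow (by omega) _) (Nat.pow_le_pow_right hΓ ?_)
    nlinarith
  · have hst := e.injective (Fin.ext huu)
    simp only [Prod.mk.injEq] at hst
    have htake : (s u).2.take ((C.c + 1) * t + 1) = (s u').2.take ((C.c + 1) * t + 1) := by
      apply List.ext_getElem?
      intro i
      rw [List.getElem?_take, List.getElem?_take]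
      split_ifs with hi
      · exact congrFun hst.2 ⟨i, hi⟩
      · rfl
    rw [outputLength_append h, outputLength_append h, Nat.add_sub_cancel_left,
      Nat.add_sub_cancel_left, hs, hs]
    have hb := h.1.boundedFrom (u.map some)
    rw [hs] at hb
    rw [outputFrom_eq_of_take (y := (s u).2) (q := (s u).1) hb htake
      (by rw [List.length_map]; exact Nat.lt_succ_of_le (Nat.mul_le_mul_left _ hx)), hst.1]

end PushdownCompressor

namespace PushdownCompressor

/-! ### The copying compressor -/

section

/-- The compressor that copies its input. -/
def copier (A : Type u) : PushdownCompressor (Option A) A where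
  Q := Unit
  Γ := Unit
  finite_Q := inferInstance
  finite_Γ := inferInstance
  δ _ b _ := b.map fun _ => ((), [()])
  ν _ b _ := b.toList
  q₀ := ()
  z₀ := ()
  c := 0
  bottom q b p h := by
    obtain ⟨_, _, rfl⟩ := Option.map_eq_some_iff.1 h
    exact ⟨[], rfl⟩
  lambda_pops q a p h := by simp at h
  deterministic q a := .inl rfl

variable {A : Type u}

theorem copier_next (b : Option A) :
    (copier A).next (some ((), [()])) b = some ((), [()]) := rfl

theorem copier_run (w : List (Option A)) : (copier A).run w = some ((), [()]) := by
  change w.foldl _ (some ((), [()])) = _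
  induction w with
  | nil => rfl
  | cons b w ih => exact ih

theorem copier_output (w : List (Option A)) : (copier A).output w = some w.reduceOption := by
  change (copier A).outputFrom (some ((), [()])) w = _
  induction w with
  | nil => rfl
  | cons b w ih =>
    simp only [outputFrom, Option.bind_some]
    rw [copier_next]
    erw [ih]
    cases b <;> rfl

theorem copier_output_withEnd (w : List A) : (copier A).output (withEnd w) = some w := by
  rw [copier_output, withEnd, List.reduceOption_append]
  simp [List.reduceOption]

theorem copier_isILPDCwE (A : Type u) : (copier A).IsILPDCwE := by
  refine ⟨?_, fun w => ?_, fun v w h => ?_⟩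
  · intro w b s t hs ht
    rw [copier_run] at hs
    obtain rfl := Option.some_injective _ hs
    obtain rfl := Option.some_injective _ ht
    exact le_rfl
  · rw [copier_output_withEnd, finalState, copier_run]
    exact ⟨rfl, rfl⟩
  · simpa [copier_output_withEnd] using congrArg Prod.fst h

theorem copier_endOutput (w : List A) : (copier A).endOutput w = w := by
  simp [endOutput, copier_output_withEnd]

end

-- A union bound over types of contexts: if every list `d` failed in some context, sorting the lists
-- by the type of that context would leave too few of them. Crucially, `N` is fixed before `ℓ`.
open Classical in
theorem exists_incompressible_words {A : Type u} [Finite A] [Nontrivial A] {m : ℕ}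
    {C : Fin m → PushdownCompressor (Option A) A} (hC : ∀ j, (C j).IsILPDCwE) (q : ℕ)
    (pre : ℕ → List A) :
    ∃ N, 0 < N ∧ ∀ ℓ₀, ∃ ℓ ≥ ℓ₀, ∃ d : Fin N → Fin ((q + 1) * ℓ) → A, ∀ u, ∃ i : Fin N, ∀ j,
      q * ℓ ≤ (C j).outputLength (u ++ pre i ++ List.ofFn (d i)) -
        (C j).outputLength (u ++ pre i) := by
  have := Fintype.ofFinite A
  choose K hK using fun j => (hC j).exists_types
  set κ : ℕ := ∑ j, Nat.card (C j).Q * Nat.card (C j).Γ with hκ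
  set X : ℕ := (∏ j, K j) ^ (q + 2) + 1 with hX
  set σ : ℕ := Nat.card A with hσ
  have hσ2 : 2 ≤ σ := Finite.one_lt_card
  refine ⟨2 * X, by omega, fun ℓ₀ => ?_⟩
  set N : ℕ := 2 * X with hN
  -- Large enough to dominate every prefix `pre i` and to give `κ ^ N < 2 ^ ℓ`.
  set ℓ : ℕ := ℓ₀ + 1 + ∑ i ∈ Finset.range N, (pre i).length + κ ^ N with hℓ
  have hpre : ∀ i : Fin N, (pre i).length ≤ ℓ := by
    intro i
    have := Finset.single_le_sum (f := fun i => (pre i).length) (fun _ _ => Nat.zero_le _)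
      (Finset.mem_range.2 i.2)
    omega
  refine ⟨ℓ, by omega, ?_⟩
  choose τ hτ hτ' using fun j => hK j ((q + 2) * ℓ) (Nat.mul_pos (by omega) (by omega))
  let T : List A → ∀ j, Fin (K j ^ ((q + 2) * ℓ)) := fun u j => ⟨τ j u, hτ j u⟩
  let bad : List A → Fin N → Finset (Fin ((q + 1) * ℓ) → A) := fun u i =>
    {x | ∃ j, (C j).outputLength (u ++ pre i ++ List.ofFn x) - (C j).outputLength (u ++ pre i) <
      q * ℓ}
  have hbadT : ∀ u u', T u = T u' → bad u = bad u' := by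
    intro u u' huu
    have key : ∀ j, ∀ x : List A, x.length ≤ (q + 2) * ℓ →
        (C j).outputLength (u ++ x) - (C j).outputLength u =
          (C j).outputLength (u' ++ x) - (C j).outputLength u' := fun j =>
      hτ' j u u' (congrArg Fin.val (congrFun huu j))
    have mono : ∀ j (v w : List A), (C j).outputLength v ≤ (C j).outputLength (v ++ w) := by
      intro j v w
      rw [outputLength_append (hC j)]
      exact Nat.le_add_right _ _
    ext i x
    simp only [bad, Finset.mem_filter, Finset.mem_univ, true_and]
    refine exists_congr fun j => ?_
    -- The horizon `(q + 2) * ℓ` covers `pre i` followed by a word.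
    have hq : (q + 2) * ℓ = (q + 1) * ℓ + ℓ := by ring
    have h1 := key j (pre i) (by have := hpre i; omega)
    have h2 := key j (pre i ++ List.ofFn x) (by
      have := hpre i
      rw [List.length_append, List.length_ofFn]
      omega)
    rw [← List.append_assoc, ← List.append_assoc] at h2
    have := mono j u (pre i)
    have := mono j u' (pre i)
    have := mono j (u ++ pre i) (List.ofFn x)
    have := mono j (u' ++ pre i) (List.ofFn x)
    omega
  have hbad : ∀ u i, (bad u i).card ≤ κ * σ ^ (q * ℓ) := by
    intro u i
    have : bad u i = Finset.univ.biUnion fun j => ({x | (C j).outputLength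
        (u ++ pre i ++ List.ofFn x) - (C j).outputLength (u ++ pre i) < q * ℓ} :
          Finset (Fin ((q + 1) * ℓ) → A)) := by
      ext x
      simp [bad]
    rw [this, hκ, Finset.sum_mul]
    refine Finset.card_biUnion_le.trans (Finset.sum_le_sum fun j _ => ?_)
    refine le_trans (le_of_eq ?_) ((hC j).card_compressed_le (u ++ pre i) ((q + 1) * ℓ) (q * ℓ))
    rw [Nat.card_eq_fintype_card, Fintype.card_subtype]
  by_contra! hcon
  choose U hU using fun d : Fin N → Fin ((q + 1) * ℓ) → A => hcon d
  -- All lists with the same type of failing context lie in one product of `N` bad sets.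
  have hcard := Finset.card_le_mul_card_image_of_maps_to (s := Finset.univ) (t := Finset.univ)
    (f := fun d => T (U d)) (fun _ _ => Finset.mem_univ _) ((κ * σ ^ (q * ℓ)) ^ N) (by
      intro θ _
      by_cases hne : ∃ d₀, T (U d₀) = θ
      · obtain ⟨d₀, rfl⟩ := hne
        have hsub : ({d | T (U d) = T (U d₀)} : Finset (Fin N → Fin ((q + 1) * ℓ) → A)) ⊆
            Fintype.piFinset (bad (U d₀)) := by
          intro d hd
          rw [Finset.mem_filter] at hd
          rw [Fintype.mem_piFinset, ← hbadT _ _ hd.2]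
          intro i
          simpa [bad] using hU d i
        refine (Finset.card_le_card hsub).trans ?_
        rw [Fintype.card_piFinset]
        refine (Finset.prod_le_pow_card _ _ _ fun i _ => hbad (U d₀) i).trans (le_of_eq ?_)
        rw [Finset.card_univ, Fintype.card_fin]
      · rw [Finset.card_eq_zero.2]
        · exact Nat.zero_le _
        · refine Finset.filter_eq_empty_iff.2 fun d _ hd => hne ⟨d, hd⟩)
  rw [Finset.card_univ, Finset.card_univ, Fintype.card_pi, Finset.prod_const, Finset.card_univ,
    Fintype.card_fin, Fintype.card_pi, Finset.prod_const, Finset.card_univ, Fintype.card_fin,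
    Fintype.card_pi, ← Nat.card_eq_fintype_card (α := A), ← hσ] at hcard
  simp only [Fintype.card_fin] at hcard
  rw [Finset.prod_pow, pow_mul _ (q + 2), mul_pow, add_mul, one_mul, pow_add, mul_pow, mul_assoc,
    mul_left_comm, ← pow_mul σ ℓ, mul_comm ℓ, pow_mul σ N] at hcard
  have h1 : (σ ^ N) ^ ℓ ≤ κ ^ N * ((∏ j, K j) ^ (q + 2)) ^ ℓ :=
    Nat.le_of_mul_le_mul_left hcard (by positivity)
  have h2 : κ ^ N < 2 ^ ℓ := lt_of_le_of_lt (by omega : κ ^ N ≤ ℓ) Nat.lt_two_pow_self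
  have h3 : ((∏ j, K j) ^ (q + 2)) ^ ℓ ≤ X ^ ℓ := Nat.pow_le_pow_left (by omega) _
  -- The factor `X` outweighs the number of types per unit of `ℓ`, and the factor `2` outweighs `κ ^
  -- N`.
  have h4 : 2 * X ≤ σ ^ N :=
    (Nat.lt_two_pow_self (n := N)).le.trans (Nat.pow_le_pow_left hσ2 _)
  have h5 : (2 * X) ^ ℓ ≤ (σ ^ N) ^ ℓ := Nat.pow_le_pow_left h4 _
  have h6 : κ ^ N * ((∏ j, K j) ^ (q + 2)) ^ ℓ ≤ κ ^ N * X ^ ℓ := Nat.mul_le_mul_left _ h3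
  have h7 : κ ^ N * X ^ ℓ < 2 ^ ℓ * X ^ ℓ := Nat.mul_lt_mul_of_pos_right h2 (by positivity)
  rw [mul_pow] at h5
  omega

end PushdownCompressor

namespace DictCompressor

/-! ### Dictionaries on the tape and the inputs that use them -/

section

variable {A : Type u} {B : Type}

/-- The tape with content `l` followed by blanks. -/
def tapeOf (l : List (Option (Option B))) (i : ℕ) : Option (Option B) :=
  l.getD i (some none)

theorem tapeOf_length (l : List (Option (Option B))) : tapeOf l l.length = some none := by
  simp [tapeOf]

theorem tapeOf_append_length_add (l l' : List (Option (Option B))) (i : ℕ) :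
    tapeOf (l ++ l') (l.length + i) = tapeOf l' i := by
  rw [tapeOf, tapeOf, List.getD_append_right _ _ _ _ (Nat.le_add_right _ _),
    Nat.add_sub_cancel_left]

theorem tapeOf_append_blank (l : List (Option (Option B))) :
    tapeOf (l ++ [some none]) = tapeOf l := by
  funext i
  rcases lt_trichotomy i l.length with h | rfl | h
  · simp [tapeOf, List.getD_eq_getElem?_getD, List.getElem?_append_left h]
  · simp [tapeOf]
  · rw [tapeOf, tapeOf, List.getD_eq_default _ _ (by simpa using h),
      List.getD_eq_default _ _ h.le]

theorem update_tapeOf (l : List (Option (Option B))) (c : Option (Option B)) :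
    Function.update (tapeOf l) l.length c = tapeOf (l ++ [c]) := by
  funext i
  rcases lt_trichotomy i l.length with h | rfl | h
  · rw [Function.update_of_ne h.ne]
    simp [tapeOf, List.getD_eq_getElem?_getD, List.getElem?_append_left h]
  · simp [tapeOf, List.getD_eq_getElem?_getD]
  · rw [Function.update_of_ne h.ne', tapeOf, tapeOf, List.getD_eq_default _ _ h.le,
      List.getD_eq_default _ _ (by simpa using h)]

/-- The cells of a word. -/
def wordCells (e : A → B) (d : List A) : List (Option (Option B)) :=
  d.map fun s => some (some (e s))

@[simp]
theorem length_wordCells (e : A → B) (d : List A) : (wordCells e d).length = d.length := by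
  simp [wordCells]

/-- The cells of a dictionary, without the left end mark. -/
def dictCells (e : A → B) (ds : List (List A)) : List (Option (Option B)) :=
  ds.flatMap fun d => wordCells e d ++ [some none]

theorem dictCells_append (e : A → B) (ds ds' : List (List A)) :
    dictCells e (ds ++ ds') = dictCells e ds ++ dictCells e ds' := by
  simp [dictCells]

theorem dictCells_cons (e : A → B) (d : List A) (ds : List (List A)) :
    dictCells e (d :: ds) = wordCells e d ++ some none :: dictCells e ds := by
  simp [dictCells]

/-- The tape that holds a dictionary. -/
def dictTape (e : A → B) (ds : List (List A)) : ℕ → Option (Option B) :=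
  tapeOf (none :: dictCells e ds)

theorem dictTape_nil (e : A → B) : dictTape e [] = startTape B := by
  funext i
  cases i <;> simp [dictTape, dictCells, tapeOf, startTape]

variable {e : A → B}

theorem dictTape_word (ds ds' : List (List A)) (d : List A) (i : ℕ) :
    dictTape e (ds ++ d :: ds') ((dictCells e ds).length + 1 + i) =
      tapeOf (wordCells e d ++ some none :: dictCells e ds') i := by
  rw [dictTape, dictCells_append, dictCells_cons, ← List.cons_append]
  exact tapeOf_append_length_add (none :: dictCells e ds) _ i

theorem tapeOf_wordCells_lt {d : List A} {i : ℕ} (hi : i < d.length)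
    (l : List (Option (Option B))) : tapeOf (wordCells e d ++ l) i = some (some (e d[i])) := by
  rw [tapeOf, List.getD_eq_getElem?_getD, List.getElem?_append_left (by simpa using hi)]
  simp [wordCells, hi]

theorem tapeOf_wordCells_length (d : List A) (l : List (Option (Option B))) :
    tapeOf (wordCells e d ++ some none :: l) d.length = some none := by
  have := tapeOf_append_length_add (wordCells e d) (some none :: l) 0
  rw [length_wordCells] at this
  exact this

theorem skipFrom_eq {t : ℕ → Option (Option B)} {n : ℕ} {fuel h : ℕ} (hn : n ≤ fuel)
    (h1 : ∀ k < n, (t (h + k)).join.isSome) (h2 : (t (h + n)).join = none) :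
    skipFrom t fuel h = h + n := by
  induction n generalizing fuel h with
  | zero =>
    cases fuel with
    | zero => rfl
    | succ fuel => rw [skipFrom, if_neg (by simpa using h2), Nat.add_zero]
  | succ n ih =>
    obtain ⟨fuel, rfl⟩ := Nat.exists_eq_succ_of_ne_zero (by omega : fuel ≠ 0)
    rw [skipFrom, if_pos (by simpa using h1 0 (Nat.succ_pos n)), ih (by omega), Nat.add_right_comm, Nat.add_assoc]
    · intro k hk
      have := h1 (k + 1) (by omega)
      rwa [← Nat.add_assoc, Nat.add_right_comm] at this
    · rwa [Nat.add_right_comm, Nat.add_assoc]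

/-- The position of a separator is determined by the words in front of it. -/
theorem length_dictCells_take_succ {ds : List (List A)} {i : ℕ} (hi : i < ds.length) :
    (dictCells e (ds.take (i + 1))).length =
      (dictCells e (ds.take i)).length + 1 + ds[i].length := by
  rw [List.take_succ_eq_append_getElem hi, dictCells_append, dictCells_cons]
  simp [dictCells]
  omega

theorem length_dictCells_take_le (ds : List (List A)) (i : ℕ) :
    (dictCells e (ds.take i)).length ≤ (dictCells e ds).length := by
  conv_rhs => rw [← List.take_append_drop i ds, dictCells_append, List.length_append]
  exact Nat.le_add_right _ _

theorem dictTape_getElem {ds : List (List A)} {i : ℕ} (hi : i < ds.length) (k : ℕ) :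
    dictTape e ds ((dictCells e (ds.take i)).length + 1 + k) =
      tapeOf (wordCells e ds[i] ++ some none :: dictCells e (ds.drop (i + 1))) k := by
  rw [← dictTape_word, ← List.drop_eq_getElem_cons hi, List.take_append_drop]

variable [DecidableEq A] [DecidableEq B] {a b : A} {D : ℕ}

/-- The head rests on the separator before a word, the end mark for the first one, and each `b`
carries it across that word to the next separator. -/
theorem enc_skips (hab : a ≠ b) {ds : List (List A)} (hD : (dictCells e ds).length < D) {i : ℕ}
    (hi : i ≤ ds.length) (w : List A) :
    enc a b e D .cmd (dictTape e ds) 0 (List.replicate i b ++ w) =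
      List.replicate i b ++ enc a b e D .cmd (dictTape e ds)
        (dictCells e (ds.take i)).length w := by
  induction i generalizing w with
  | zero => simp [dictCells]
  | succ i ih =>
    have h1 := length_dictCells_take_le (e := e) ds i
    have h2 := length_dictCells_take_le (e := e) ds (i + 1)
    have h3 := length_dictCells_take_succ (e := e) (Nat.lt_of_succ_le hi)
    rw [List.replicate_succ', List.append_assoc, List.append_assoc, ih (by omega)]
    congr 1
    rw [List.singleton_append, enc, if_pos (by omega), if_neg hab.symm, List.singleton_append,
      skipFrom_eq (n := (ds[i]'(by omega)).length) (by omega), h3]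
    · intro k hk
      rw [dictTape_getElem (by omega), tapeOf_wordCells_lt hk]
      rfl
    · rw [dictTape_getElem (by omega), tapeOf_wordCells_length]
      rfl

theorem enc_read_word {t : ℕ → Option (Option B)} {d : List A} {h : ℕ} (hD : h + d.length ≤ D)
    (ht : ∀ k (hk : k < d.length), t (h + k) = some (some (e d[k]))) (w : List A) :
    enc a b e D .read t h (d ++ w) = enc a b e D .read t (h + d.length) w := by
  induction d generalizing h with
  | nil => rfl
  | cons s d ih =>
    rw [List.length_cons] at hD
    have h0 := ht 0 (by simp)
    rw [List.cons_append, enc_read_match (by omega) (by rw [Nat.add_zero] at h0; rw [h0]; rfl),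
      ih (by omega), List.length_cons, Nat.add_right_comm, Nat.add_assoc]
    intro k hk
    have := ht (k + 1) (by simpa using hk)
    rwa [← Nat.add_assoc, Nat.add_right_comm] at this

/-- The input that makes the compressor look up the word number `i` of its dictionary. -/
def lookup (a b : A) (i : ℕ) (d : List A) : List A :=
  List.replicate i b ++ [a] ++ d ++ [a]

/-- The word is matched on the tape and emits nothing. The three `a` are the start of the match, the
flag at the blank and the return. -/
theorem enc_lookup (hab : a ≠ b) {ds : List (List A)} (hD : (dictCells e ds).length < D) {i : ℕ}
    (hi : i < ds.length) (w : List A) :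
    enc a b e D .cmd (dictTape e ds) 0 (lookup a b i ds[i] ++ w) =
      (List.replicate i b ++ [a, a, a]) ++ enc a b e D .cmd (dictTape e ds) 0 w := by
  have h2 := length_dictCells_take_le (e := e) ds (i + 1)
  have h3 := length_dictCells_take_succ (e := e) hi
  rw [lookup, List.append_assoc, List.append_assoc, List.append_assoc, enc_skips hab hD hi.le,
    List.append_assoc]
  congr 1
  rw [List.singleton_append, enc, if_pos (by omega), if_pos rfl, enc_read_word (by omega),
    List.singleton_append, enc_read_blank_cons (by omega), if_pos rfl]
  · rfl
  · rw [dictTape_getElem hi, tapeOf_wordCells_length]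
    rfl
  · intro k hk
    rw [dictTape_getElem hi, tapeOf_wordCells_lt hk]

/-- At a blank, `b` asks for writing and the next symbol fills the cell; the flag makes this three
output symbols for two input symbols. -/
theorem enc_write_word (hab : a ≠ b) {l : List (Option (Option B))} {d : List A}
    (hD : l.length + d.length < D) (w : List A) :
    enc a b e D .read (tapeOf l) l.length (d.flatMap (fun s => [b, s]) ++ a :: w) =
      d.flatMap (fun s => [a, b, s]) ++ a :: a ::
        enc a b e D .cmd (tapeOf (l ++ wordCells e d)) 0 w := by
  induction d generalizing l with
  | nil =>
    rw [List.length_nil] at hD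
    simp only [List.flatMap_nil, List.nil_append, wordCells, List.map_nil, List.append_nil]
    rw [enc_read_blank_cons (by omega) (by rw [tapeOf_length]; rfl), if_pos rfl]
  | cons s d ih =>
    rw [List.length_cons] at hD
    have := ih (l := l ++ [some (some (e s))])
      (by rw [List.length_append, List.length_singleton]; omega)
    rw [List.length_append, List.length_singleton] at this
    rw [List.flatMap_cons, List.append_assoc, List.cons_append,
      enc_read_blank_cons (by omega) (by rw [tapeOf_length]; rfl), if_neg hab.symm,
      List.singleton_append, enc, if_pos (by omega), update_tapeOf, this]
    simp [wordCells]

/-- The input that makes the compressor append a word to a dictionary of `M` words. -/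
def insertion (a b : A) (M : ℕ) (d : List A) : List A :=
  List.replicate M b ++ a :: (d.flatMap (fun s => [b, s]) ++ [a])

theorem enc_insertion (hab : a ≠ b) {ds : List (List A)} {d : List A}
    (hD : (dictCells e (ds ++ [d])).length < D) (w : List A) :
    enc a b e D .cmd (dictTape e ds) 0 (insertion a b ds.length d ++ w) =
      (List.replicate ds.length b ++ a :: (d.flatMap (fun s => [a, b, s]) ++ [a, a])) ++
        enc a b e D .cmd (dictTape e (ds ++ [d])) 0 w := by
  have hlen : (dictCells e (ds ++ [d])).length = (dictCells e ds).length + d.length + 1 := by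
    rw [dictCells_append, dictCells_cons]
    simp [dictCells]
    omega
  have h := enc_write_word (a := a) (b := b) (e := e) (D := D) hab
    (l := none :: dictCells e ds) (d := d) (by rw [List.length_cons]; omega) w
  -- The separator after the new word is a blank that is already there.
  rw [List.length_cons, ← tapeOf_append_blank (_ ++ _)] at h
  have ht : tapeOf (none :: dictCells e ds ++ wordCells e d ++ [some none]) =
      dictTape e (ds ++ [d]) := by
    simp [dictTape, dictCells]
  rw [ht] at h
  rw [insertion, List.append_assoc, enc_skips hab (by omega) le_rfl, List.take_length,
    List.append_assoc]
  congr 1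
  rw [List.cons_append, enc, if_pos (by omega), if_pos rfl, List.append_assoc,
    List.singleton_append, dictTape, h]
  simp

/-- The input that makes the compressor append a list of words to a dictionary of `M` words. -/
def insertions (a b : A) : ℕ → List (List A) → List A
  | _, [] => []
  | M, d :: ds => insertion a b M d ++ insertions a b (M + 1) ds

/-- The output `o` is chosen before `D`, so one count serves all sufficiently long prefixes,
although `D` varies with their length. -/
theorem enc_insertions (hab : a ≠ b) (e : A → B) (ds ds' : List (List A)) :
    ∃ o : List A, o.length ≤ 3 * (insertions a b ds.length ds').length ∧
      ∀ D, (dictCells e (ds ++ ds')).length < D → ∀ w,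
        enc a b e D .cmd (dictTape e ds) 0 (insertions a b ds.length ds' ++ w) =
          o ++ enc a b e D .cmd (dictTape e (ds ++ ds')) 0 w := by
  induction ds' generalizing ds with
  | nil => exact ⟨[], by simp, fun D _ w => by simp [insertions]⟩
  | cons d ds' ih =>
    obtain ⟨o, ho, h⟩ := ih (ds ++ [d])
    rw [List.length_append, List.length_singleton] at ho h
    refine ⟨(List.replicate ds.length b ++ a :: (d.flatMap (fun s => [a, b, s]) ++ [a, a])) ++ o,
      ?_, fun D hD w => ?_⟩
    · rw [insertions, insertion]
      simp
      omega
    · rw [List.append_assoc ds] at h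
      have hD' : (dictCells e (ds ++ [d])).length < D := by
        refine lt_of_le_of_lt ?_ hD
        change _ ≤ (dictCells e (ds ++ ([d] ++ ds'))).length
        rw [← List.append_assoc, dictCells_append e (ds ++ [d]),
          List.length_append]
        exact Nat.le_add_right _ _
      rw [insertions, List.append_assoc, enc_insertion hab hD', h D hD, List.singleton_append]
      simp only [List.append_assoc]

end

end DictCompressor

/-! ### Asymptotics -/

/-- Lengths of a growing sequence of words together with stage numbers: in the stage `r`, the word
is extended by at most `ul r` symbols as long as it is shorter than `thr r`; afterwards, it is
extended by `hl r` symbols and the stage `r + 1` begins. -/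
structure StagedGrowth (len q thr hl ul : ℕ → ℕ) : Prop where
  zero : q 0 = 0
  step : ∀ k, (thr (q k) ≤ len k ∧ q (k + 1) = q k + 1 ∧ len (k + 1) = len k + hl (q k)) ∨
    (len k < thr (q k) ∧ q (k + 1) = q k ∧ len (k + 1) ≤ len k + ul (q k))
  strictMono : StrictMono len
  le_thr : ∀ r, (r + 1) * (ul (r + 1) + ∑ i ∈ Finset.range (r + 1), hl i) ≤ thr r

namespace StagedGrowth

variable {len q thr hl ul : ℕ → ℕ}

theorem monotone_stage (H : StagedGrowth len q thr hl ul) : Monotone q :=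
  monotone_nat_of_le_succ fun k => by
    obtain ⟨_, h, _⟩ | ⟨_, h, _⟩ := H.step k <;> omega

theorem exists_le_stage (H : StagedGrowth len q thr hl ul) (r : ℕ) : ∃ k, r ≤ q k := by
  induction r with
  | zero => exact ⟨0, Nat.zero_le _⟩
  | succ r ih =>
    obtain ⟨k, hk⟩ := ih
    by_contra! hcon
    have key : ∀ i, len (k + i) < thr r := by
      intro i
      have h1 := hcon (k + i)
      have h2 := hcon (k + i + 1)
      have h3 := H.monotone_stage (Nat.le_add_right k i)
      have h4 : q (k + i) = r := by omega
      obtain ⟨_, h, _⟩ | ⟨h, _, _⟩ := H.step (k + i)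
      · omega
      · rwa [h4] at h
    have h1 := key (thr r)
    have h2 := H.strictMono.le_apply (x := k + thr r)
    omega

theorem thr_le (H : StagedGrowth len q thr hl ul) {k r : ℕ} (hr : r < q k) : thr r ≤ len k := by
  induction k with
  | zero => rw [H.zero] at hr; omega
  | succ k ih =>
    have hlt := H.strictMono (Nat.lt_succ_self k)
    obtain ⟨h1, h2, _⟩ | ⟨_, h2, _⟩ := H.step k
    · by_cases hr' : r < q k
      · exact (ih hr').trans hlt.le
      · obtain rfl : r = q k := by omega
        exact h1.trans hlt.le
    · exact (ih (by omega)).trans hlt.le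

/-- A stage ends only when the word is long compared with its header and with the extensions of the
next stage. Hence ratios need control only at the ends of steps. -/
theorem eventually_gap_le (H : StagedGrowth len q thr hl ul) (p : ℕ) :
    ∃ K, ∀ k ≥ K, p * len (k + 1) ≤ (p + 1) * len k := by
  obtain ⟨K, hK⟩ := H.exists_le_stage (p + 1)
  refine ⟨K, fun k hk => ?_⟩
  have hq : p + 1 ≤ q k := hK.trans (H.monotone_stage hk)
  obtain ⟨h1, _, h3⟩ | ⟨_, _, h3⟩ := H.step k
  · have h4 : hl (q k) ≤ ∑ i ∈ Finset.range (q k + 1), hl i :=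
      Finset.single_le_sum (fun _ _ => Nat.zero_le _) (Finset.self_mem_range_succ _)
    have h5 := H.le_thr (q k)
    have : p * hl (q k) ≤ len k := by
      refine le_trans (Nat.mul_le_mul (by omega : p ≤ q k + 1) ?_) (h5.trans h1)
      omega
    rw [h3]
    linarith
  · obtain ⟨r, hr⟩ : ∃ r, q k = r + 1 := ⟨q k - 1, by omega⟩
    have h4 := H.thr_le (show r < q k by omega)
    have h5 := H.le_thr r
    have : p * ul (q k) ≤ len k := by
      refine le_trans (Nat.mul_le_mul (by omega : p ≤ r + 1) ?_) (h5.trans h4)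
      rw [hr]
      omega
    have := Nat.mul_le_mul_left p h3
    linarith

/-- This says that `g` has upper growth `o(len)`; it is applied to the compressed length and to the
loss of a pushdown compressor. Headers are negligible in total, and other steps contribute a
vanishing fraction of their length. -/
theorem eventually_deficiency_le (H : StagedGrowth len q thr hl ul) {g : ℕ → ℤ} {k₀ : ℕ}
    (hg : ∀ k ≥ k₀, (q (k + 1) = q k + 1 ∧ g (k + 1) ≤ g k + 3 * hl (q k)) ∨
      (q (k + 1) = q k ∧ (q k + 1) * (g (k + 1) - g k) ≤ 2 * (len (k + 1) - len k))) (p : ℕ) :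
    ∃ K, ∀ k ≥ K, p * g k ≤ len k := by
  -- From this stage on, `6 * p ≤ q k + 1` controls the ordinary steps and `18 * p ≤ q k` absorbs
  -- all headers.
  obtain ⟨K, hK⟩ := H.exists_le_stage (18 * p + 1)
  set k₁ := max k₀ K with hk₁
  have hq : ∀ k ≥ k₁, 18 * p + 1 ≤ q k := fun k hk =>
    hK.trans (H.monotone_stage ((le_max_right _ _).trans hk))
  have key : ∀ k ≥ k₁, 6 * p * (g k - g k₁) ≤
      2 * (len k - len k₁) + 18 * p * ∑ i ∈ Finset.range (q k), (hl i : ℤ) := by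
    intro k hk
    induction k, hk using Nat.le_induction with
    | base =>
      have : (0 : ℤ) ≤ ∑ i ∈ Finset.range (q k₁), (hl i : ℤ) :=
        Finset.sum_nonneg fun _ _ => Int.natCast_nonneg _
      rw [sub_self, sub_self, mul_zero, mul_zero, zero_add]
      positivity
    | succ k hk ih =>
      have hlt : (len k : ℤ) < len (k + 1) := by exact_mod_cast H.strictMono (Nat.lt_succ_self k)
      obtain ⟨h1, h2⟩ | ⟨h1, h2⟩ := hg k ((le_max_left _ _).trans hk)
      · rw [h1, Finset.sum_range_succ]
        have h3 := mul_le_mul_of_nonneg_left h2 (by positivity : (0 : ℤ) ≤ 6 * p)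
        linarith
      · rw [h1]
        have h3 : 6 * (p : ℤ) * (g (k + 1) - g k) ≤ 2 * (len (k + 1) - len k) := by
          by_cases h : 0 ≤ g (k + 1) - g k
          · refine le_trans (mul_le_mul_of_nonneg_right ?_ h) h2
            have := hq k hk
            have : (18 * p + 1 : ℤ) ≤ q k := by exact_mod_cast this
            linarith [Int.natCast_nonneg p]
          · have : 6 * (p : ℤ) * (g (k + 1) - g k) ≤ 0 :=
              mul_nonpos_of_nonneg_of_nonpos (by positivity) (by omega)
            linarith
        linarith
  refine ⟨max k₁ (6 * p * g k₁).toNat, fun k hk => ?_⟩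
  have hk1 : k₁ ≤ k := (le_max_left _ _).trans hk
  have h1 := key k hk1
  have h2 : 6 * (p : ℤ) * g k₁ ≤ len k := by
    have h3 : (6 * p * g k₁).toNat ≤ len k :=
      ((le_max_right _ _).trans hk).trans H.strictMono.le_apply
    exact (Int.self_le_toNat _).trans (by exact_mod_cast h3)
  have h3 : 18 * (p : ℤ) * ∑ i ∈ Finset.range (q k), (hl i : ℤ) ≤ len k := by
    have h0 := hq k hk1
    obtain ⟨r, hr⟩ : ∃ r, q k = r + 1 := ⟨q k - 1, by omega⟩
    have h4 := (H.le_thr r).trans (H.thr_le (show r < q k by omega))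
    have h5 : 18 * p * ∑ i ∈ Finset.range (q k), hl i ≤ len k := by
      refine le_trans (Nat.mul_le_mul (by omega : 18 * p ≤ r + 1) ?_) h4
      rw [hr]
      omega
    exact_mod_cast h5
  have h4 : (0 : ℤ) ≤ len k₁ := Int.natCast_nonneg _
  have h5 : (0 : ℤ) ≤ len k := Int.natCast_nonneg _
  have : 6 * ((p : ℤ) * g k) ≤ 4 * len k := by linarith
  linarith

theorem exists_between (H : StagedGrowth len q thr hl ul) {n : ℕ} (hn : len 0 ≤ n) :
    ∃ k, len k ≤ n ∧ n < len (k + 1) := by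
  have hex : ∃ k, n < len k := ⟨n + 1, lt_of_lt_of_le (Nat.lt_succ_self n) H.strictMono.le_apply⟩
  classical
  have h1 := Nat.find_spec hex
  have h2 : Nat.find hex ≠ 0 := fun h => by rw [h] at h1; omega
  obtain ⟨k, hk⟩ := Nat.exists_eq_succ_of_ne_zero h2
  refine ⟨k, not_lt.1 (Nat.find_min hex (by omega)), ?_⟩
  rwa [hk] at h1

end StagedGrowth

theorem eventually_mul_size_le (p : ℕ) : ∀ᶠ n : ℕ in atTop, p * n.size ≤ n := by
  refine eventually_atTop.2 ⟨2 ^ (4 * p + 2), fun n hn => ?_⟩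
  have h1 : 4 * p + 2 < n.size := Nat.lt_size.2 hn
  obtain ⟨s, hs⟩ : ∃ s, n.size = s + 1 := ⟨n.size - 1, by omega⟩
  have h2 : 2 ^ s ≤ n := Nat.lt_size.1 (by omega)
  obtain ⟨h, hh⟩ : ∃ h, s = h + h ∨ s = h + h + 1 := ⟨s / 2, by omega⟩
  have h3 : h + 1 ≤ 2 ^ h := Nat.lt_two_pow_self
  have h4 : 2 ^ (h + h) ≤ 2 ^ s := Nat.pow_le_pow_right (by norm_num) (by omega)
  rw [pow_add] at h4
  calc p * n.size ≤ p * (2 * (h + 1)) := Nat.mul_le_mul_left _ (by omega)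
    _ = 2 * p * (h + 1) := by ring
    _ ≤ 2 ^ h * 2 ^ h := Nat.mul_le_mul (by omega) h3
    _ ≤ n := h4.trans h2

theorem upperRatio_eq_zero {A : Type u} {T : List A → List A} {S : ℕ → A}
    (h : ∀ p : ℕ, ∀ᶠ n in atTop, p * (T (seqPrefix S n)).length ≤ n) : upperRatio T S = 0 := by
  refine le_antisymm (ENNReal.le_of_forall_pos_le_add fun ε hε _ => ?_) bot_le
  rw [zero_add]
  obtain ⟨p, hp⟩ := ENNReal.exists_inv_nat_lt (ENNReal.coe_ne_zero.2 hε.ne')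
  refine le_trans ?_ hp.le
  refine limsup_le_of_le (by isBoundedDefault) ?_
  filter_upwards [h p, eventually_gt_atTop 0] with n hn hn0
  rw [ENNReal.div_le_iff (by exact_mod_cast hn0.ne') (ENNReal.natCast_ne_top n)]
  by_cases hp0 : p = 0
  · subst hp0
    simp at hp
  · rw [mul_comm, ← div_eq_mul_inv, ENNReal.le_div_iff_mul_le (.inl (by exact_mod_cast hp0))
      (.inl (ENNReal.natCast_ne_top p)), mul_comm]
    exact_mod_cast hn

theorem one_le_lowerRatio {A : Type u} {T : List A → List A} {S : ℕ → A}
    (h : ∀ p : ℕ, ∀ᶠ n in atTop, p * n ≤ p * (T (seqPrefix S n)).length + n) :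
    1 ≤ lowerRatio T S := by
  refine ENNReal.le_of_forall_pos_le_add fun ε hε _ => ?_
  obtain ⟨p, hp⟩ := ENNReal.exists_inv_nat_lt (ENNReal.coe_ne_zero.2 hε.ne')
  refine le_trans (tsub_le_iff_right.1 ?_) (add_le_add_right hp.le _)
  refine le_liminf_of_le (by isBoundedDefault) ?_
  filter_upwards [h p, eventually_gt_atTop 0] with n hn hn0
  have hn' : (n : ℝ≥0∞) ≠ 0 := by exact_mod_cast hn0.ne'
  rw [tsub_le_iff_right]
  by_cases hp0 : p = 0
  · subst hp0
    simp
  · have hp' : (p : ℝ≥0∞) ≠ 0 := by exact_mod_cast hp0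
    rw [← ENNReal.mul_le_mul_iff_right hn' (ENNReal.natCast_ne_top n)]
    rw [← ENNReal.mul_le_mul_iff_right hp' (ENNReal.natCast_ne_top p), mul_one, mul_add, mul_add,
      ENNReal.mul_div_cancel hn' (ENNReal.natCast_ne_top n), mul_left_comm,
      ENNReal.mul_inv_cancel hp' (ENNReal.natCast_ne_top p), mul_one]
    exact_mod_cast hn

/-! ### The sequence -/

theorem length_seqPrefix {A : Type u} (S : ℕ → A) (n : ℕ) : (seqPrefix S n).length = n := by
  simp [seqPrefix]

theorem exists_seqPrefix_eq {A : Type u} [Inhabited A] {u v : ℕ → List A}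
    (hu : ∀ k, u (k + 1) = u k ++ v k) (hv : ∀ k, v k ≠ []) :
    ∃ S : ℕ → A, ∀ k n, n ≤ (u k).length → seqPrefix S n = (u k).take n := by
  have hlen : ∀ k, k ≤ (u k).length := by
    intro k
    induction k with
    | zero => exact Nat.zero_le _
    | succ k ih =>
      have := List.length_pos_iff.2 (hv k)
      rw [hu, List.length_append]
      omega
  have hpre : ∀ {k l}, k ≤ l → u k <+: u l := by
    intro k l hkl
    induction l, hkl using Nat.le_induction with
    | base => exact List.prefix_rfl
    | succ l _ ih => exact ih.trans (by rw [hu]; exact List.prefix_append _ _)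
  have hget : ∀ {k l i}, i < (u k).length → i < (u l).length → (u k)[i]? = (u l)[i]? := by
    intro k l i hk hl
    rcases le_total k l with h | h
    · obtain ⟨y, hy⟩ := hpre h
      rw [← hy, List.getElem?_append_left hk]
    · obtain ⟨y, hy⟩ := hpre h
      rw [← hy, List.getElem?_append_left hl]
  refine ⟨fun i => ((u (i + 1))[i]?).getD default, fun k n hn => List.ext_getElem? fun i => ?_⟩
  rw [List.getElem?_take, seqPrefix, List.getElem?_map]
  split_ifs with hi
  · have h1 : i < (u (i + 1)).length := hlen (i + 1)
    rw [List.getElem?_range hi, Option.map_some, hget (k := k) (l := i + 1) (by omega) h1,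
      List.getElem?_eq_getElem h1]
    rfl
  · rw [List.getElem?_eq_none (by simpa using hi)]
    rfl

/-- Repeated extension of a word, controlled by stages. -/
theorem exists_staged_words {A : Type u} (u₀ : List A) (thr : ℕ → ℕ) (hdr : ℕ → List A)
    (use : List A → ℕ → List A) :
    ∃ (u v : ℕ → List A) (q : ℕ → ℕ), u 0 = u₀ ∧ q 0 = 0 ∧ (∀ k, u (k + 1) = u k ++ v k) ∧
      ∀ k, (thr (q k) ≤ (u k).length ∧ q (k + 1) = q k + 1 ∧ v k = hdr (q k)) ∨
        ((u k).length < thr (q k) ∧ q (k + 1) = q k ∧ v k = use (u k) (q k)) := by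
  let next : List A × ℕ → List A × ℕ := fun s =>
    if thr s.2 ≤ s.1.length then (hdr s.2, s.2 + 1) else (use s.1 s.2, s.2)
  let X : ℕ → List A × ℕ := fun k => Nat.rec (u₀, 0) (fun _ s => (s.1 ++ (next s).1, (next s).2)) k
  refine ⟨fun k => (X k).1, fun k => (next (X k)).1, fun k => (X k).2, rfl, rfl, fun _ => rfl,
    fun k => ?_⟩
  have hq : (X (k + 1)).2 = (next (X k)).2 := rfl
  dsimp only
  rw [hq]
  by_cases h : thr (X k).2 ≤ (X k).1.length
  · exact .inl ⟨h, by simp only [next, if_pos h], by simp only [next, if_pos h]⟩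
  · exact .inr ⟨not_le.1 h, by simp only [next, if_neg h], by simp only [next, if_neg h]⟩

open DictCompressor PushdownCompressor

/-- The prefixes are the addresses `b^(M+i) a` of the new words behind `M` old ones; `ℓ ≥ M + N + 3`
makes the address at most a fraction `1 / (q + 1)` of the word. -/
theorem exists_dictionary_words {A : Type u} [Finite A] [Nontrivial A]
    {C : ℕ → PushdownCompressor (Option A) A} (hC : ∀ j, (C j).IsILPDCwE) (a b : A) (q M : ℕ) :
    ∃ (W : List (List A)) (L : ℕ), (q + 1) * (M + W.length + 3) ≤ L ∧
      ∀ u, ∃ (i : ℕ) (hi : i < W.length), W[i].length = L ∧ ∀ j ≤ q,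
        q * L ≤ (q + 1) * ((C j).outputLength (u ++ (List.replicate (M + i) b ++ [a]) ++ W[i]) -
          (C j).outputLength (u ++ (List.replicate (M + i) b ++ [a]))) := by
  obtain ⟨N, _, h⟩ := exists_incompressible_words (m := q + 1) (C := fun j => C j)
    (fun j => hC j) q (fun i => List.replicate (M + i) b ++ [a])
  obtain ⟨ℓ, hℓ, d, hd⟩ := h (M + N + 3)
  refine ⟨List.ofFn fun i => List.ofFn (d i), (q + 1) * ℓ, ?_, fun u => ?_⟩
  · rw [List.length_ofFn]
    exact Nat.mul_le_mul_left _ hℓ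
  · obtain ⟨i, hi⟩ := hd u
    refine ⟨i, by rw [List.length_ofFn]; exact i.2, by simp, fun j hj => ?_⟩
    have := hi ⟨j, Nat.lt_succ_of_le hj⟩
    simp only [List.getElem_ofFn]
    rw [mul_left_comm]
    exact Nat.mul_le_mul_left _ this

theorem outputLength_le_append {A : Type u} {C : PushdownCompressor (Option A) A}
    (hC : C.IsILPDCwE) (u w : List A) : C.outputLength u ≤ C.outputLength (u ++ w) := by
  rw [outputLength_append hC]
  exact Nat.le_add_right _ _

/-- The pushdown loss `2 / (q + 1)` has two equal sources: the incompressibility bound `q / (q + 1)`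
for the word, and the address, counted as entirely lost. -/
theorem exists_lookup {A : Type u} [DecidableEq A] {B : Type} [DecidableEq B]
    {C : ℕ → PushdownCompressor (Option A) A} (hC : ∀ j, (C j).IsILPDCwE) {a b : A} (hab : a ≠ b)
    (e : A → B) {q L : ℕ} {ds W : List (List A)} (hL : (q + 1) * (ds.length + W.length + 3) ≤ L)
    {u : List A} {i : ℕ} (hi : i < W.length) (hlen : W[i].length = L)
    (h : ∀ j ≤ q, q * L ≤ (q + 1) *
      ((C j).outputLength (u ++ (List.replicate (ds.length + i) b ++ [a]) ++ W[i]) -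
        (C j).outputLength (u ++ (List.replicate (ds.length + i) b ++ [a])))) :
    ∃ v : List A, v ≠ [] ∧ v.length ≤ ds.length + W.length + 3 + L ∧
      (∃ x : List A, (q + 1) * x.length ≤ v.length ∧
        ∀ D, (dictCells e (ds ++ W)).length < D → ∀ w,
          enc a b e D .cmd (dictTape e (ds ++ W)) 0 (v ++ w) =
            x ++ enc a b e D .cmd (dictTape e (ds ++ W)) 0 w) ∧
      ∀ j ≤ q, (q + 1) * (v.length + (C j).outputLength u) ≤
        (q + 1) * (C j).outputLength (u ++ v) + 2 * v.length := by
  have hv : (lookup a b (ds.length + i) W[i]).length = ds.length + i + 2 + L := by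
    simp [lookup, hlen]
    omega
  have hmul : (q + 1) * (ds.length + i + 3) ≤ L :=
    le_trans (Nat.mul_le_mul_left _ (by omega)) hL
  refine ⟨lookup a b (ds.length + i) W[i], by simp [lookup], by omega,
    ⟨List.replicate (ds.length + i) b ++ [a, a, a], ?_, fun D hD w => ?_⟩, fun j hj => ?_⟩
  · rw [hv, List.length_append, List.length_replicate]
    exact hmul.trans (by omega)
  · have hget : (ds ++ W)[ds.length + i]'(by rw [List.length_append]; omega) = W[i] := by
      rw [List.getElem_append_right (Nat.le_add_right _ _)]
      simp
    rw [← hget]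
    exact enc_lookup hab hD _ w
  · have h1 := outputLength_le_append (hC j) u (List.replicate (ds.length + i) b ++ [a])
    have h2 := outputLength_le_append (hC j)
      (u ++ (List.replicate (ds.length + i) b ++ [a])) W[i]
    have h3 := outputLength_le_append (hC j)
      (u ++ (List.replicate (ds.length + i) b ++ [a]) ++ W[i]) [a]
    have h4 := h j hj
    have h5 : u ++ lookup a b (ds.length + i) W[i] =
        u ++ (List.replicate (ds.length + i) b ++ [a]) ++ W[i] ++ [a] := by
      simp [lookup]
    rw [hv, h5]
    set x := (C j).outputLength u
    set y := (C j).outputLength (u ++ (List.replicate (ds.length + i) b ++ [a]))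
    set z := (C j).outputLength (u ++ (List.replicate (ds.length + i) b ++ [a]) ++ W[i])
    have h6 : q * L + (q + 1) * x ≤ (q + 1) *
        (C j).outputLength (u ++ (List.replicate (ds.length + i) b ++ [a]) ++ W[i] ++ [a]) := by
      refine (Nat.add_le_add_right h4 _).trans ?_
      rw [← Nat.mul_add]
      exact Nat.mul_le_mul_left _ (by omega)
    nlinarith

theorem exists_sequence {A : Type u} [Finite A] [Nontrivial A] [DecidableEq A]
    {B : Type} [DecidableEq B]
    {C : ℕ → PushdownCompressor (Option A) A} (hC : ∀ j, (C j).IsILPDCwE) {a b : A} (hab : a ≠ b)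
    (e : A → B) :
    ∃ S : ℕ → A,
      (∀ p : ℕ, ∀ᶠ n in atTop, p * (compress a b e (seqPrefix S n)).length ≤ n) ∧
      ∀ j, ∀ p : ℕ, ∀ᶠ n in atTop, p * n ≤ p * (C j).outputLength (seqPrefix S n) + n := by
  choose W L hL hW using exists_dictionary_words hC a b
  -- During the stage `q` the dictionary is `ds (q + 1)`; the initial word installs `ds 1`, and the
  -- header `hdr q` leads on to `ds (q + 2)`.
  let ds : ℕ → List (List A) := fun q => Nat.rec [] (fun q l => l ++ W q l.length) q
  have ds_succ : ∀ q, ds (q + 1) = ds q ++ W q (ds q).length := fun _ => rfl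
  have hcells : Monotone fun q => (dictCells e (ds q)).length := by
    refine monotone_nat_of_le_succ fun q => ?_
    rw [ds_succ, dictCells_append, List.length_append]
    exact Nat.le_add_right _ _
  have huse : ∀ (u : List A) (q : ℕ), ∃ v : List A, v ≠ [] ∧
      v.length ≤ (ds q).length + (W q (ds q).length).length + 3 + L q (ds q).length ∧
      (∃ x : List A, (q + 1) * x.length ≤ v.length ∧
        ∀ D, (dictCells e (ds (q + 1))).length < D → ∀ w,
          enc a b e D .cmd (dictTape e (ds (q + 1))) 0 (v ++ w) =
            x ++ enc a b e D .cmd (dictTape e (ds (q + 1))) 0 w) ∧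
      ∀ j ≤ q, (q + 1) * (v.length + (C j).outputLength u) ≤
        (q + 1) * (C j).outputLength (u ++ v) + 2 * v.length := by
    intro u q
    obtain ⟨i, hi, h1, h2⟩ := hW q (ds q).length u
    exact exists_lookup hC hab e (hL q _) hi h1 h2
  choose use use_ne use_len use_enc use_out using huse
  let hdr : ℕ → List A := fun q =>
    insertions a b (ds (q + 1)).length (W (q + 1) (ds (q + 1)).length)
  have hdr_ne : ∀ q, hdr q ≠ [] := by
    intro q
    obtain ⟨i, hi, -⟩ := hW (q + 1) (ds (q + 1)).length []
    obtain ⟨d, l, hd⟩ := List.exists_cons_of_length_pos (Nat.zero_lt_of_lt hi)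
    simp [hdr, hd, insertions, insertion]
  have hdr_enc : ∀ q, ∃ x : List A, x.length ≤ 3 * (hdr q).length ∧
      ∀ D, (dictCells e (ds (q + 2))).length < D → ∀ w,
        enc a b e D .cmd (dictTape e (ds (q + 1))) 0 (hdr q ++ w) =
          x ++ enc a b e D .cmd (dictTape e (ds (q + 2))) 0 w := fun q =>
    enc_insertions hab e (ds (q + 1)) (W (q + 1) (ds (q + 1)).length)
  let ul : ℕ → ℕ := fun q => (ds q).length + (W q (ds q).length).length + 3 + L q (ds q).length
  let hl : ℕ → ℕ := fun q => (hdr q).length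
  -- The first summand gives the growth condition; the power of two guarantees room for the next
  -- dictionary.
  let thr : ℕ → ℕ := fun r => (r + 1) * (ul (r + 1) + ∑ i ∈ Finset.range (r + 1), hl i) +
    2 ^ (dictCells e (ds (r + 2))).length
  obtain ⟨u, v, q, hu0, hq0, huv, hstep⟩ :=
    exists_staged_words (insertions a b 0 (W 0 0)) thr hdr use
  have hv : ∀ k, v k ≠ [] := by
    intro k
    obtain ⟨_, _, h⟩ | ⟨_, _, h⟩ := hstep k <;> rw [h]
    · exact hdr_ne _
    · exact use_ne _ _
  have hlen : ∀ k, (u (k + 1)).length = (u k).length + (v k).length := by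
    intro k
    rw [huv, List.length_append]
  have H : StagedGrowth (fun k => (u k).length) q thr hl ul := by
    refine ⟨hq0, fun k => ?_, strictMono_nat_of_lt_succ fun k => ?_, fun r => Nat.le_add_right _ _⟩
    · obtain ⟨h1, h2, h3⟩ | ⟨h1, h2, h3⟩ := hstep k
      · exact .inl ⟨h1, h2, by rw [hlen, h3]⟩
      · exact .inr ⟨h1, h2, by rw [hlen, h3]; exact Nat.add_le_add_left (use_len _ _) _⟩
    · have := List.length_pos_iff.2 (hv k)
      rw [hlen]
      omega
  have : Inhabited A := ⟨a⟩
  obtain ⟨S, hS⟩ := exists_seqPrefix_eq huv hv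
  have hbetween : ∀ K, ∀ᶠ n in atTop, ∃ k ≥ K, ∃ y, seqPrefix S n = u k ++ y ∧
      (u k).length + y.length = n ∧ n < (u (k + 1)).length := by
    intro K
    filter_upwards [eventually_ge_atTop (u K).length] with n hn
    obtain ⟨k, hk1, hk2⟩ := H.exists_between
      ((H.strictMono.monotone (Nat.zero_le K)).trans hn : (u 0).length ≤ n)
    refine ⟨k, ?_, (v k).take (n - (u k).length), ?_, ?_, hk2⟩
    · have := H.strictMono.lt_iff_lt.1 (lt_of_le_of_lt hn hk2)
      omega
    · rw [hS (k + 1) n hk2.le, huv, List.take_append, List.take_of_length_le hk1]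
    · rw [List.length_take]
      rw [hlen] at hk2
      omega
  refine ⟨S, fun p => ?_, fun j p => ?_⟩
  · have hx : ∀ k, ∃ x : List A,
        ((q (k + 1) = q k + 1 ∧ x.length ≤ 3 * hl (q k)) ∨
          (q (k + 1) = q k ∧ (q k + 1) * x.length ≤ (v k).length)) ∧
        ∀ D, (dictCells e (ds (q (k + 1) + 1))).length < D → ∀ w,
          enc a b e D .cmd (dictTape e (ds (q k + 1))) 0 (v k ++ w) =
            x ++ enc a b e D .cmd (dictTape e (ds (q (k + 1) + 1))) 0 w := by
      intro k
      obtain ⟨_, h2, h3⟩ | ⟨_, h2, h3⟩ := hstep k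
      · obtain ⟨x, hx, h⟩ := hdr_enc (q k)
        exact ⟨x, .inl ⟨h2, hx⟩, by rw [h2, h3]; exact h⟩
      · obtain ⟨x, hx, h⟩ := use_enc (u k) (q k)
        exact ⟨x, .inr ⟨h2, by rw [h3]; exact hx⟩, by rw [h2, h3]; exact h⟩
    choose x hxlen hxenc using hx
    obtain ⟨o₀, -, ho₀⟩ := enc_insertions hab e [] (W 0 0)
    let g : ℕ → ℕ := fun k => o₀.length + ∑ i ∈ Finset.range k, (x i).length
    have hg : ∀ k, ∃ o : List A, o.length = g k ∧
        ∀ D, (dictCells e (ds (q k + 1))).length < D → ∀ w,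
          enc a b e D .cmd (dictTape e []) 0 (u k ++ w) =
            o ++ enc a b e D .cmd (dictTape e (ds (q k + 1))) 0 w := by
      intro k
      induction k with
      | zero =>
        refine ⟨o₀, by simp [g], ?_⟩
        rw [hu0, hq0]
        exact ho₀
      | succ k ih =>
        obtain ⟨o, ho, h⟩ := ih
        refine ⟨o ++ x k, ?_, fun D hD w => ?_⟩
        · rw [List.length_append, ho]
          simp only [g]
          rw [Finset.sum_range_succ, Nat.add_assoc]
        · have hq : q k ≤ q (k + 1) := H.monotone_stage (Nat.le_succ k)
          have hc := hcells (Nat.add_le_add_right hq 1)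
          rw [huv, List.append_assoc, h D (lt_of_le_of_lt hc hD), hxenc k D hD,
            List.append_assoc]
    obtain ⟨K₁, hK₁⟩ := H.eventually_deficiency_le (g := fun k => (g k : ℤ)) (k₀ := 0) (by
      intro k _
      have hgk : g (k + 1) = g k + (x k).length := by
        simp only [g]
        rw [Finset.sum_range_succ, Nat.add_assoc]
      obtain ⟨h1, h2⟩ | ⟨h1, h2⟩ := hxlen k
      · exact .inl ⟨h1, by rw [hgk]; push_cast; exact_mod_cast Nat.add_le_add_left h2 _⟩
      · refine .inr ⟨h1, ?_⟩
        rw [hgk, hlen]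
        push_cast
        rw [add_sub_cancel_left, add_sub_cancel_left]
        have : ((q k : ℤ) + 1) * (x k).length ≤ (v k).length := by exact_mod_cast h2
        linarith [Int.natCast_nonneg (v k).length]) (8 * p)
    -- Completed steps, the unfinished step and the terms in `n.size` contribute at most `1 + 2 + 1`
    -- times `n` to `8 * p` times the code length.
    obtain ⟨K₂, hK₂⟩ := H.eventually_gap_le (8 * p)
    obtain ⟨K₃, hK₃⟩ := H.exists_le_stage 1
    filter_upwards [hbetween (max K₁ (max K₂ K₃)), eventually_mul_size_le (40 * p),
      eventually_gt_atTop 0] with n hn hsize hn0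
    obtain ⟨k, hk, y, hy, hylen, hn2⟩ := hn
    have h1 := hK₁ k ((le_max_left _ _).trans hk)
    have h2 := hK₂ k (((le_max_left _ _).trans (le_max_right _ _)).trans hk)
    have h3 : 1 ≤ q k := hK₃.trans
      (H.monotone_stage (((le_max_right _ _).trans (le_max_right _ _)).trans hk))
    have h1' : 8 * p * g k ≤ (u k).length := by exact_mod_cast h1
    -- The stage before `q k` is finished, so its threshold makes `n` large enough; stage `0` has no
    -- predecessor, whence `K₃`.
    have hD : (dictCells e (ds (q k + 1))).length < n.size := by
      obtain ⟨r, hr⟩ : ∃ r, q k = r + 1 := ⟨q k - 1, by omega⟩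
      rw [Nat.lt_size, hr]
      refine le_trans ?_ ((H.thr_le (show r < q k by omega)).trans (by omega : (u k).length ≤ n))
      exact Nat.le_add_left _ _
    obtain ⟨o, ho, henc⟩ := hg k
    have h4 : (compress a b e (seqPrefix S n)).length ≤ g k + 2 * y.length + 2 * n.size + 3 := by
      rw [compress, length_seqPrefix, List.length_append, List.length_replicate, List.length_cons,
        ← dictTape_nil (e := e), hy, henc _ hD, List.length_append, ho]
      have := length_enc_le (a := a) (b := b) (e := e) n.size .cmd (dictTape e (ds (q k + 1)))
        (h := 0) (Nat.zero_le _) y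
      omega
    have h5 : 0 < n.size := Nat.size_pos.2 hn0
    have h6 : 8 * p * y.length ≤ (u k).length := by
      have : 8 * p * ((u k).length + y.length) ≤ 8 * p * (u (k + 1)).length :=
        Nat.mul_le_mul_left _ (by omega)
      linarith
    have h7 : 8 * p * (compress a b e (seqPrefix S n)).length ≤
        8 * p * (g k + 2 * y.length + 5 * n.size) := Nat.mul_le_mul_left _ (by omega)
    have h8 : 8 * p * (compress a b e (seqPrefix S n)).length ≤ 4 * n := by linarith
    linarith
  -- The words of the stage `q` resist `C j` only for `j ≤ q`.
  · obtain ⟨k₀, hk₀⟩ := H.exists_le_stage j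
    obtain ⟨K₁, hK₁⟩ := H.eventually_deficiency_le (k₀ := k₀)
      (g := fun k => ((u k).length : ℤ) - (C j).outputLength (u k)) (by
      intro k hk
      obtain ⟨_, h2, h3⟩ | ⟨_, h2, h3⟩ := hstep k
      · refine .inl ⟨h2, ?_⟩
        have h4 := outputLength_le_append (hC j) (u k) (v k)
        rw [← huv] at h4
        have h5 : (u (k + 1)).length = (u k).length + hl (q k) := by rw [hlen, h3]
        omega
      · refine .inr ⟨h2, ?_⟩
        have h4 := use_out (u k) (q k) j (hk₀.trans (H.monotone_stage hk))
        rw [← h3, ← huv] at h4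
        have h5 : ((q k : ℤ) + 1) * ((v k).length + (C j).outputLength (u k)) ≤
          (q k + 1) * (C j).outputLength (u (k + 1)) + 2 * (v k).length := by exact_mod_cast h4
        rw [hlen]
        push_cast
        linarith) (2 * p)
    obtain ⟨K₂, hK₂⟩ := H.eventually_gap_le (2 * p)
    filter_upwards [hbetween (max K₁ K₂)] with n hn
    obtain ⟨k, hk, y, hy, hylen, hn2⟩ := hn
    have h1 := hK₁ k ((le_max_left _ _).trans hk)
    have h2 := hK₂ k ((le_max_right _ _).trans hk)
    have h1' : 2 * p * (u k).length ≤ (u k).length + 2 * p * (C j).outputLength (u k) := by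
      have : (2 * p * (u k).length : ℤ) ≤
        (u k).length + 2 * p * (C j).outputLength (u k) := by push_cast at h1; linarith
      exact_mod_cast this
    have h6 : 2 * p * y.length ≤ (u k).length := by
      have : 2 * p * ((u k).length + y.length) ≤ 2 * p * (u (k + 1)).length :=
        Nat.mul_le_mul_left _ (by omega)
      linarith
    have h7 : p * (C j).outputLength (u k) ≤ p * (C j).outputLength (seqPrefix S n) := by
      rw [hy]
      exact Nat.mul_le_mul_left _ (outputLength_le_append (hC j) _ _)
    rw [← hylen] at h7 ⊢
    linarith

theorem theorem7 (A : Type u) [Finite A] [Nontrivial A] :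
    ∃ S : ℕ → A, RPlogon S = 0 ∧ rhoPD S = 1 := by
  classical
  obtain ⟨a, b, hab⟩ := exists_pair_ne A
  -- The work alphabet must live in `Type`, so input symbols are stored through `e`.
  obtain ⟨n, ⟨e⟩⟩ := Finite.exists_equiv_fin A
  obtain ⟨f, hf⟩ : ∃ f : ℕ → List A → ℕ,
      {g | ∃ C : PushdownCompressor (Option A) A, C.IsILPDCwE ∧ C.outputLength = g} =
        Set.range f := by
    refine Set.Countable.exists_eq_range ?_ ⟨_, copier A, copier_isILPDCwE A, rfl⟩
    refine (countable_outputLength A).mono ?_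
    rintro _ ⟨C, -, rfl⟩
    exact ⟨C, rfl⟩
  choose C hC hCf using fun j => hf.ge (Set.mem_range_self j)
  obtain ⟨S, hS1, hS2⟩ := exists_sequence hC hab e
  refine ⟨S, ?_, le_antisymm ?_ ?_⟩
  · refine le_antisymm ?_ bot_le
    rw [← upperRatio_eq_zero hS1]
    exact iInf₂_le _ (isILplog_compress hab e.injective)
  -- Copying already attains the ratio one.
  · refine (iInf₂_le (copier A) (copier_isILPDCwE A)).trans ?_
    refine liminf_le_of_le (by isBoundedDefault) fun c hc => ?_
    obtain ⟨n, h1, hn⟩ := (hc.and (eventually_gt_atTop 0)).exists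
    rw [copier_endOutput, length_seqPrefix] at h1
    exact h1.trans ENNReal.div_self_le_one
  · refine le_iInf₂ fun C' hC' => one_le_lowerRatio fun p => ?_
    obtain ⟨j, hj⟩ := hf.le ⟨C', hC', rfl⟩
    filter_upwards [hS2 j p] with n hn
    rw [hCf, hj] at hn
    have := Nat.mul_le_mul_left p (outputLength_le_endOutput hC' (seqPrefix S n))
    omega
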